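/- Let $E$ be the elliptic curve over $\mathbb{Q}$ given by $Y^2 = X(X-8)(X-9) = X^3-17X^2+72X$. Then the group $E(\mathbb{Q})$ is finitely generated of rank $0$, its torsion subgroup satisfies $$E(\mathbb{Q})_{\mathrm{tors}} \cong \mathbb{Z}/2\mathbb{Z}\oplus\mathbb{Z}/4\mathbb{Z},$$ and the conductor of $E$ is $48$. Here the conductor is $\prod_p p^{f_p}$ over all primes $p$, with $f_p = v_p(\Delta_{p}) + 1 - m_p$, where $\Delta_{p}$ is the discriminant of a minimal Weierstrass equation of $E$ over $\mathbb{Q}_p$ and $m_p$ is the number of geometric irreducible components (counted without multiplicity) of the special fibre of the minimal regular model of $E$ over $\mathbb{Z}_p$, as given by the Kodaira type of $E$ at $p$ in Tate's algorithm. -/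

import Mathlib

namespace WeierstrassCurve

section Kodaira

/-- Kodaira's symbols for the special fibre of the minimal regular model of an elliptic curve
over a discretely valued field: `I n` is `Iₙ` (with `I 0` good reduction) and `IStar n` is
`Iₙ*`. -/
inductive KodairaType : Type
  | I (n : ℕ)
  | II
  | III
  | IV
  | IStar (n : ℕ)
  | IVStar
  | IIIStar
  | IIStar

/-- The number of geometric irreducible components, counted without multiplicity, of the special
fibre of the minimal regular model. -/
def KodairaType.numComponents : KodairaType → ℕ
  | .I 0 => 1
  | .I (n + 1) => n + 1
  | .II => 1
  | .III => 2
  | .IV => 3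
  | .IStar n => n + 5
  | .IVStar => 7
  | .IIIStar => 8
  | .IIStar => 9

instance : Nonempty KodairaType := ⟨.I 0⟩

variable (R : Type*) [CommRing R] [IsDomain R] [IsDiscreteValuationRing R]

open IsDiscreteValuationRing

/-- The integral Weierstrass equation `V` over a discrete valuation ring `R` (with perfect residue
field) is in the terminal normal form that Tate's algorithm assigns to the given Kodaira type.
Here `v` is the normalized valuation of `R`. For `Iₙ` with `n > 0` the singular point of the
reduction is `(0, 0)` and is a node. In the other cases of bad reduction it is `(0, 0)` and is a
cusp with tangent `y = 0`. The last condition for `I₀*` says that the cubic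
`T³ + a₂π⁻¹T² + a₄π⁻²T + a₆π⁻³` has nonzero discriminant in the residue field. For `Iₙ*` with
`n > 0` it says that the last quadratic polynomial that occurs in the subprocedure of Tate's
algorithm, which is `Y² + a₃π⁻ᵏY - a₆π⁻²ᵏ` for `n = 2k - 3` and
`a₂π⁻¹X² + a₄π⁻ᵏ⁻¹X + a₆π⁻²ᵏ⁻¹` for `n = 2k - 2`, has distinct roots. -/
def IsTateNormalForm (V : WeierstrassCurve R) : KodairaType → Prop :=
  let v : R → ℕ∞ := fun a ↦ addVal R a
  fun
  | .I 0 => v V.Δ = 0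
  | .I (n + 1) => 1 ≤ v V.a₃ ∧ 1 ≤ v V.a₄ ∧ 1 ≤ v V.a₆ ∧ v V.b₂ = 0 ∧ v V.Δ = (n + 1 : ℕ)
  | .II => 1 ≤ v V.a₁ ∧ 1 ≤ v V.a₂ ∧ 1 ≤ v V.a₃ ∧ 1 ≤ v V.a₄ ∧ v V.a₆ = 1
  | .III => 1 ≤ v V.a₁ ∧ 1 ≤ v V.a₂ ∧ 1 ≤ v V.a₃ ∧ v V.a₄ = 1 ∧ 2 ≤ v V.a₆
  | .IV => 1 ≤ v V.a₁ ∧ 1 ≤ v V.a₂ ∧ 1 ≤ v V.a₃ ∧ 2 ≤ v V.a₄ ∧ 2 ≤ v V.a₆ ∧ v V.b₆ = 2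
  | .IStar 0 => 1 ≤ v V.a₁ ∧ 1 ≤ v V.a₂ ∧ 2 ≤ v V.a₃ ∧ 2 ≤ v V.a₄ ∧ 3 ≤ v V.a₆ ∧
      v (V.a₂ ^ 2 * V.a₄ ^ 2 - 4 * V.a₄ ^ 3 - 4 * V.a₂ ^ 3 * V.a₆ - 27 * V.a₆ ^ 2
        + 18 * V.a₂ * V.a₄ * V.a₆) = 6
  | .IStar (n + 1) => 1 ≤ v V.a₁ ∧ v V.a₂ = 1 ∧
      ((∃ k : ℕ, n + 1 + 3 = 2 * k ∧ k ≤ v V.a₃ ∧ (k + 1 : ℕ) ≤ v V.a₄ ∧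
          (2 * k : ℕ) ≤ v V.a₆ ∧ v V.b₆ = (2 * k : ℕ)) ∨
        (∃ k : ℕ, n + 1 + 2 = 2 * k ∧ (k + 1 : ℕ) ≤ v V.a₃ ∧ (k + 1 : ℕ) ≤ v V.a₄ ∧
          (2 * k + 1 : ℕ) ≤ v V.a₆ ∧
          v (V.a₄ ^ 2 - 4 * V.a₂ * V.a₆) = (2 * k + 2 : ℕ)))
  | .IVStar => 1 ≤ v V.a₁ ∧ 2 ≤ v V.a₂ ∧ 2 ≤ v V.a₃ ∧ 3 ≤ v V.a₄ ∧ 4 ≤ v V.a₆ ∧ v V.b₆ = 4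
  | .IIIStar => 1 ≤ v V.a₁ ∧ 2 ≤ v V.a₂ ∧ 3 ≤ v V.a₃ ∧ v V.a₄ = 3 ∧ 5 ≤ v V.a₆
  | .IIStar => 1 ≤ v V.a₁ ∧ 2 ≤ v V.a₂ ∧ 3 ≤ v V.a₃ ∧ 4 ≤ v V.a₄ ∧ v V.a₆ = 5

variable {K : Type*} [Field K] [Algebra R K] [IsFractionRing R K]

/-- `W` is isomorphic over `K` to a minimal Weierstrass equation in the Tate normal form of
type `t`. By Tate's algorithm this holds for exactly one `t` when `W` is an elliptic curve and
the residue field of `R` is perfect. -/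
def HasKodairaType (W : WeierstrassCurve K) (t : KodairaType) : Prop :=
  ∃ V : WeierstrassCurve R, (∃ C : VariableChange K, C • W = V.baseChange K) ∧
    IsMinimal R (V.baseChange K) ∧ V.IsTateNormalForm R t

/-- The Kodaira type of an elliptic curve over the fraction field of `R`. -/
noncomputable def kodairaType (W : WeierstrassCurve K) : KodairaType :=
  Classical.epsilon (W.HasKodairaType R)

/-- The conductor exponent `f = v(Δ_min) + 1 - m` (Ogg's formula), with `Δ_min` the minimal
discriminant and `m` the number of geometric irreducible components of the special fibre of the
minimal regular model. -/
noncomputable def conductorExponent (W : WeierstrassCurve K) : ℕ :=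
  (addVal R ((W.minimal R).integralModel R).Δ).toNat + 1 - (W.kodairaType R).numComponents

end Kodaira

/-- The conductor `∏ₚ p ^ fₚ` of an elliptic curve over `ℚ`, with `fₚ` the conductor exponent
of the curve over `ℚₚ`. -/
noncomputable def conductor (W : WeierstrassCurve ℚ) [W.IsElliptic] : ℕ :=
  ∏ᶠ p : Nat.Primes,
    haveI : Fact (p : ℕ).Prime := ⟨p.2⟩
    (p : ℕ) ^ (W.baseChange ℚ_[p]).conductorExponent ℤ_[p]

end WeierstrassCurve

/-- The Weierstrass curve `Y² = X³ - 17X² + 72X = X(X - 8)(X - 9)` over `ℚ`. -/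
def curveE : WeierstrassCurve ℚ := ⟨0, -17, 0, 72, 0⟩

theorem curveE_equation (x y : ℚ) :
    curveE.toAffine.Equation x y ↔ y ^ 2 = x * (x - 8) * (x - 9) := by
  rw [WeierstrassCurve.Affine.equation_iff]
  simp only [curveE]
  constructor <;> intro h <;> linear_combination h

instance curveE_isElliptic : curveE.IsElliptic := by
  rw [WeierstrassCurve.isElliptic_iff, isUnit_iff_ne_zero]
  norm_num [curveE, WeierstrassCurve.Δ, WeierstrassCurve.b₂, WeierstrassCurve.b₄,
    WeierstrassCurve.b₆, WeierstrassCurve.b₈]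

theorem Int.exists_eq_sq_of_isCoprime_of_pos {a b c : ℤ} (h : IsCoprime a b) (ha : 0 < a)
    (e : a * b = c ^ 2) : ∃ x, a = x ^ 2 := by
  obtain ⟨x, hx | hx⟩ := Int.sq_of_isCoprime h e
  · exact ⟨x, hx⟩
  · nlinarith [sq_nonneg x]

theorem IsCoprime.of_sub_mul {R : Type*} [CommRing R] {m n : R} (h : IsCoprime (m - n) (m * n)) :
    IsCoprime m n := by
  have h1 : IsCoprime (m - n) n := h.of_mul_right_right
  obtain ⟨x, y, hxy⟩ := h1
  exact ⟨x, y - x, by linear_combination hxy⟩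

theorem IsCoprime.of_sq_add_sq_eq {a b c : ℤ} (h : IsCoprime a b) (e : a ^ 2 + b ^ 2 = c ^ 2) :
    IsCoprime c b := by
  rw [← IsCoprime.pow_iff two_pos two_pos, ← e]
  simpa [add_comm] using IsCoprime.mul_add_right_left (h.pow (m := 2) (n := 2)) 1

theorem Int.three_dvd_of_dvd_sq_add_sq {a b : ℤ} (h : 3 ∣ a ^ 2 + b ^ 2) : 3 ∣ a ∧ 3 ∣ b := by
  have ha : a % 3 = 0 ∨ a % 3 = 1 ∨ a % 3 = 2 := by omega
  have hb : b % 3 = 0 ∨ b % 3 = 1 ∨ b % 3 = 2 := by omega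
  have h0 : (a ^ 2 + b ^ 2) % 3 = 0 := Int.emod_eq_zero_of_dvd h
  rcases ha with ha | ha | ha <;> rcases hb with hb | hb | hb <;>
    simp [pow_two, Int.add_emod, Int.mul_emod, ha, hb] at h0 ⊢
  omega

/-- The curve `y² + w² = 2z²`, `y² + 9w² = 2r²` has no points over `ℚ₃`. -/
theorem eq_zero_of_twice_squares {y w z r : ℤ} (h1 : y ^ 2 + w ^ 2 = 2 * z ^ 2)
    (h2 : y ^ 2 + 9 * w ^ 2 = 2 * r ^ 2) : w = 0 := by
  induction hn : w.natAbs using Nat.strong_induction_on generalizing y w z r with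
  | _ n ih =>
    by_contra hw
    obtain ⟨⟨y, rfl⟩, ⟨r, rfl⟩⟩ := Int.three_dvd_of_dvd_sq_add_sq (a := y) (b := r)
      ⟨r ^ 2 - 3 * w ^ 2, by linear_combination h2⟩
    obtain ⟨⟨w, rfl⟩, ⟨z, rfl⟩⟩ := Int.three_dvd_of_dvd_sq_add_sq (a := w) (b := z)
      ⟨z ^ 2 - 3 * y ^ 2, by linear_combination h1⟩
    have := ih w.natAbs (by omega) (y := y) (w := w) (z := z) (r := r) (by linarith) (by linarith)
      rfl
    omega

theorem exists_primitive_solution {a b c d : ℤ} (ha : a ≠ 0) (hb : b ≠ 0)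
    (h1 : a ^ 2 + b ^ 2 = c ^ 2) (h2 : a ^ 2 + 9 * b ^ 2 = d ^ 2) :
    ∃ a' b' c' d' : ℤ, a' ≠ 0 ∧ b' ≠ 0 ∧ IsCoprime a' b' ∧ ¬ 3 ∣ a' ∧ a' ^ 2 + b' ^ 2 = c' ^ 2 ∧
      a' ^ 2 + 9 * b' ^ 2 = d' ^ 2 ∧ (b'.natAbs ≤ b.natAbs ∨ 3 * b'.natAbs ≤ a.natAbs) := by
  obtain ⟨g, a', b', hg, hcop, rfl, rfl⟩ := Int.exists_gcd_one' (m := a) (n := b)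
    (Int.gcd_pos_of_ne_zero_left _ ha)
  have hg0 : (g : ℤ) ≠ 0 := by exact_mod_cast hg.ne'
  have hgc : (g : ℤ) ∣ c := by
    rw [← Int.pow_dvd_pow_iff two_ne_zero]
    exact ⟨a' ^ 2 + b' ^ 2, by linear_combination -h1⟩
  have hgd : (g : ℤ) ∣ d := by
    rw [← Int.pow_dvd_pow_iff two_ne_zero]
    exact ⟨a' ^ 2 + 9 * b' ^ 2, by linear_combination -h2⟩
  obtain ⟨c, rfl⟩ := hgc
  obtain ⟨d, rfl⟩ := hgd
  have h1' : a' ^ 2 + b' ^ 2 = c ^ 2 :=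
    mul_left_cancel₀ (pow_ne_zero 2 hg0) (by linear_combination h1)
  have h2' : a' ^ 2 + 9 * b' ^ 2 = d ^ 2 :=
    mul_left_cancel₀ (pow_ne_zero 2 hg0) (by linear_combination h2)
  have hc : IsCoprime a' b' := Int.isCoprime_iff_gcd_eq_one.2 hcop
  have ha' : a' ≠ 0 := left_ne_zero_of_mul ha
  have hb' : b' ≠ 0 := left_ne_zero_of_mul hb
  have hle (t : ℤ) : t.natAbs ≤ (t * g).natAbs := by
    rw [Int.natAbs_mul]
    exact Nat.le_mul_of_pos_right _ (by omega)
  by_cases h3 : 3 ∣ a'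
  · obtain ⟨a, rfl⟩ := h3
    have h3d : 3 ∣ d := by
      rw [← Int.pow_dvd_pow_iff two_ne_zero]
      exact ⟨a ^ 2 + b' ^ 2, by linear_combination -h2'⟩
    obtain ⟨d, rfl⟩ := h3d
    have hc3 : IsCoprime 3 b' := hc.of_mul_left_left
    refine ⟨b', a, d, c, hb', by omega, hc.of_mul_left_right.symm, fun h ↦ ?_, by linarith,
      by linarith, Or.inr ?_⟩
    · have := hc3.isUnit_of_dvd' dvd_rfl h
      rw [Int.isUnit_iff] at this
      omega
    · have := hle (3 * a)
      rwa [Int.natAbs_mul 3 a] at this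
  · exact ⟨a', b', c, d, ha', hb', hc, h3, h1', h2', Or.inl (hle b')⟩

theorem isCoprime_three_of_not_dvd {a : ℤ} (h : ¬ 3 ∣ a) : IsCoprime a 3 :=
  ((Int.prime_three.coprime_iff_not_dvd).2 h).symm

theorem isCoprime_two_pow_of_odd {a : ℤ} (h : Odd a) (n : ℕ) : IsCoprime a (2 ^ n) :=
  ((Int.isCoprime_iff_gcd_eq_one.2 (by
    obtain ⟨k, rfl⟩ := h
    rw [← Int.isCoprime_iff_gcd_eq_one]
    exact ⟨1, -k, by ring⟩) : IsCoprime a 2)).pow_right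

theorem not_solution_of_odd_right {a b c d : ℤ} (hab : IsCoprime a b) (h3 : ¬ 3 ∣ a)
    (hb : Odd b) (ha : Even a) (hc : 0 < c) (hd : 0 < d)
    (h1 : a ^ 2 + b ^ 2 = c ^ 2) (h2 : a ^ 2 + 9 * b ^ 2 = d ^ 2) : False := by
  have hb0 : b ≠ 0 := by rintro rfl; simp at hb
  have hb2 : 0 < b ^ 2 := by positivity
  have hc_odd : Odd c := by
    have : Odd (c ^ 2) := h1 ▸ (ha.pow_of_ne_zero two_ne_zero).add_odd hb.pow
    exact (Int.odd_pow' two_ne_zero).1 this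
  have hd_odd : Odd d := by
    have : Odd (d ^ 2) := h2 ▸ (ha.pow_of_ne_zero two_ne_zero).add_odd (Odd.mul (by decide) hb.pow)
    exact (Int.odd_pow' two_ne_zero).1 this
  have hca : |a| < c := abs_lt_of_sq_lt_sq (by linarith) hc.le
  have hda : |a| < d := abs_lt_of_sq_lt_sq (by linarith) hd.le
  rw [abs_lt] at hca hda
  have h2a : IsCoprime (2 * a) b := by
    have := isCoprime_two_pow_of_odd hb 1
    rw [pow_one] at this
    exact this.symm.mul_left hab
  have h2a3 : IsCoprime (2 * a) 3 :=
    IsCoprime.mul_left ⟨-1, 1, by norm_num⟩ (isCoprime_three_of_not_dvd h3)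
  have hcb : IsCoprime c b := hab.of_sq_add_sq_eq h1
  obtain ⟨x, hx⟩ := Int.exists_eq_sq_of_isCoprime_of_pos (a := c + a) (b := c - a) (c := b)
    (IsCoprime.of_sub_mul (by
      rw [show c + a - (c - a) = 2 * a by ring,
        show (c + a) * (c - a) = b ^ 2 by linear_combination -h1]
      exact h2a.pow_right)) (by linarith) (by linear_combination -h1)
  obtain ⟨w, hw⟩ := Int.exists_eq_sq_of_isCoprime_of_pos (a := c - a) (b := c + a) (c := b)
    (IsCoprime.symm (IsCoprime.of_sub_mul (by
      rw [show c + a - (c - a) = 2 * a by ring,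
        show (c + a) * (c - a) = b ^ 2 by linear_combination -h1]
      exact h2a.pow_right))) (by linarith) (by linear_combination -h1)
  have hk : IsCoprime (d + a) (d - a) := IsCoprime.of_sub_mul (by
      rw [show d + a - (d - a) = 2 * a by ring,
        show (d + a) * (d - a) = (3 * b) ^ 2 by linear_combination -h2]
      exact (h2a3.mul_right h2a).pow_right)
  obtain ⟨y, hy⟩ := Int.exists_eq_sq_of_isCoprime_of_pos (a := d + a) (b := d - a) (c := 3 * b)
    hk (by linarith) (by linear_combination -h2)
  obtain ⟨v, hv⟩ := Int.exists_eq_sq_of_isCoprime_of_pos (a := d - a) (b := d + a) (c := 3 * b)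
    hk.symm (by linarith) (by linear_combination -h2)
  obtain ⟨D, hD⟩ : Even (d + c) := hd_odd.add_odd hc_odd
  have hdc : (d - c) * (d + c) = 8 * b ^ 2 := by linear_combination h1 - h2
  have hy_odd : Odd y := by
    have : Odd (y ^ 2) := hy ▸ hd_odd.add_even ha
    exact (Int.odd_pow' two_ne_zero).1 this
  have hw_odd : Odd w := by
    have : Odd (w ^ 2) := hw ▸ hc_odd.sub_even ha
    exact (Int.odd_pow' two_ne_zero).1 this
  have hy8 := Int.sq_mod_four_eq_one_of_odd hy_odd
  have hw8 := Int.sq_mod_four_eq_one_of_odd hw_odd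
  have hD_odd : Odd D := by
    rw [Int.odd_iff]
    omega
  have hD' : d - c = 2 * (D - c) := by linarith
  have hDD : D * (D - c) = 2 * b ^ 2 := by
    have := hdc
    rw [hD', hD] at this
    linarith
  have hcop : IsCoprime D (D - c) := IsCoprime.of_sub_mul (by
    rw [show D - (D - c) = c by ring, hDD]
    have := isCoprime_two_pow_of_odd hc_odd 1
    rw [pow_one] at this
    exact this.mul_right hcb.pow_right)
  obtain ⟨E, hE⟩ : Even (D - c) := hD_odd.sub_odd hc_odd
  obtain ⟨z, hz⟩ := Int.exists_eq_sq_of_isCoprime_of_pos (a := D) (b := E) (c := b)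
    (hcop.of_isCoprime_of_dvd_right ⟨2, by linarith⟩) (by linarith) (by
      rw [hE] at hDD; linarith)
  have hx0 : x ≠ 0 := by rintro rfl; linarith
  have hw0 : w ≠ 0 := by rintro rfl; linarith
  have hxw : x ^ 2 * w ^ 2 = b ^ 2 := by rw [← hx, ← hw]; linear_combination -h1
  have hyv : y ^ 2 * v ^ 2 = 9 * b ^ 2 := by rw [← hy, ← hv]; linear_combination -h2
  refine mul_ne_zero hw0 hx0 (eq_zero_of_twice_squares (y := y * x) (w := w * x) (z := z * x)
    (r := y * z) ?_ ?_)
  · linear_combination x ^ 2 * (hD + 2 * hz - hy - hw)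
  · linear_combination 9 * hxw - hyv + y ^ 2 * (hD + 2 * hz - hx - hv)

theorem exists_smaller_solution {a b c d : ℤ} (hab : IsCoprime a b) (h3 : ¬ 3 ∣ a)
    (hb0 : b ≠ 0) (hb : Even b) (hc : 0 < c) (hd : 0 < d)
    (h1 : a ^ 2 + b ^ 2 = c ^ 2) (h2 : a ^ 2 + 9 * b ^ 2 = d ^ 2) :
    ∃ y w z r : ℤ, y ≠ 0 ∧ w ≠ 0 ∧ y ^ 2 + w ^ 2 = z ^ 2 ∧ y ^ 2 + 9 * w ^ 2 = r ^ 2 ∧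
      w.natAbs < b.natAbs ∧ y.natAbs < 3 * b.natAbs := by
  have hb2 : 0 < b ^ 2 := by positivity
  have ha_odd : Odd a := by
    rw [← Int.not_even_iff_odd]
    intro ha
    have := hab.isUnit_of_dvd' ha.two_dvd hb.two_dvd
    rw [Int.isUnit_iff] at this
    omega
  have hc_odd : Odd c := by
    have : Odd (c ^ 2) := h1 ▸ ha_odd.pow.add_even (hb.pow_of_ne_zero two_ne_zero)
    exact (Int.odd_pow' two_ne_zero).1 this
  have hd_odd : Odd d := by
    have : Odd (d ^ 2) := h2 ▸ ha_odd.pow.add_even ((hb.pow_of_ne_zero two_ne_zero).mul_left 9)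
    exact (Int.odd_pow' two_ne_zero).1 this
  have hca : |a| < c := abs_lt_of_sq_lt_sq (by linarith) hc.le
  have hda : |a| < d := abs_lt_of_sq_lt_sq (by linarith) hd.le
  rw [abs_lt] at hca hda
  have hcb : IsCoprime c b := hab.of_sq_add_sq_eq h1
  obtain ⟨β, rfl⟩ := hb.two_dvd
  have hβ0 : β ≠ 0 := by rintro rfl; simp at hb0
  have haβ : IsCoprime a β := hab.of_mul_right_right
  have hcβ : IsCoprime c β := hcb.of_mul_right_right
  obtain ⟨n, hn⟩ : Even (c - a) := hc_odd.sub_odd ha_odd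
  obtain ⟨l, hl⟩ : Even (d - a) := hd_odd.sub_odd ha_odd
  have hmn : (n + a) * n = β ^ 2 := by
    have h : (c - a) * (c + a) = 4 * β ^ 2 := by linear_combination -h1
    rw [show c + a = (n + n) + 2 * a by linarith, hn] at h
    linarith
  have hkl : (l + a) * l = (3 * β) ^ 2 := by
    have h : (d - a) * (d + a) = 36 * β ^ 2 := by linear_combination -h2
    rw [show d + a = (l + l) + 2 * a by linarith, hl] at h
    linarith
  have hcmn : IsCoprime (n + a) n := IsCoprime.of_sub_mul (by
    rw [hmn, add_sub_cancel_left]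
    exact haβ.pow_right)
  have hckl : IsCoprime (l + a) l := IsCoprime.of_sub_mul (by
    rw [hkl, add_sub_cancel_left]
    exact ((isCoprime_three_of_not_dvd h3).mul_right haβ).pow_right)
  obtain ⟨x, hx⟩ := Int.exists_eq_sq_of_isCoprime_of_pos hcmn (by linarith) hmn
  obtain ⟨w, hw⟩ := Int.exists_eq_sq_of_isCoprime_of_pos hcmn.symm (by linarith)
    (by rw [mul_comm]; exact hmn)
  obtain ⟨y, hy⟩ := Int.exists_eq_sq_of_isCoprime_of_pos hckl (by linarith) hkl
  obtain ⟨v, hv⟩ := Int.exists_eq_sq_of_isCoprime_of_pos hckl.symm (by linarith)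
    (by rw [mul_comm]; exact hkl)
  have hx0 : x ≠ 0 := by rintro rfl; linarith
  have hw0 : w ≠ 0 := by rintro rfl; linarith
  have hy0 : y ≠ 0 := by rintro rfl; linarith
  have hv0 : v ≠ 0 := by rintro rfl; linarith
  have hDodd : Odd (y ^ 2 + w ^ 2) := by
    have hxa : x ^ 2 - w ^ 2 = a := by linarith
    have hya : y ^ 2 - v ^ 2 = a := by linarith
    have sq4 (t : ℤ) : (t ^ 2 % 4 = 0) ∨ (t ^ 2 % 4 = 1) := by
      rcases Int.even_or_odd t with ⟨s, rfl⟩ | h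
      · left; ring_nf; omega
      · right; exact Int.sq_mod_four_eq_one_of_odd h
    rw [Int.odd_iff] at ha_odd ⊢
    have := sq4 x
    have := sq4 y
    have := sq4 w
    have := sq4 v
    omega
  have hprod : (y ^ 2 + w ^ 2) * (y ^ 2 - x ^ 2) = 8 * β ^ 2 := by
    have h : (d - c) * (d + c) = 32 * β ^ 2 := by linear_combination h1 - h2
    rw [show d - c = 2 * (y ^ 2 - x ^ 2) by linarith,
      show d + c = 2 * (y ^ 2 + w ^ 2) by linarith] at h
    linarith
  have hcop : IsCoprime (y ^ 2 + w ^ 2) (y ^ 2 - x ^ 2) := IsCoprime.of_sub_mul (by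
    rw [hprod, show y ^ 2 + w ^ 2 - (y ^ 2 - x ^ 2) = c by linarith]
    exact (isCoprime_two_pow_of_odd hc_odd 3).mul_right hcβ.pow_right)
  obtain ⟨E, hE⟩ : (8 : ℤ) ∣ y ^ 2 - x ^ 2 :=
    (isCoprime_two_pow_of_odd hDodd 3).symm.dvd_of_dvd_mul_left ⟨β ^ 2, hprod⟩
  obtain ⟨z, hz⟩ := Int.exists_eq_sq_of_isCoprime_of_pos (a := y ^ 2 + w ^ 2) (b := E) (c := β)
    (hcop.of_isCoprime_of_dvd_right ⟨8, by linarith⟩) (by positivity) (by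
      rw [hE] at hprod; linarith)
  have hxw : x ^ 2 * w ^ 2 = β ^ 2 := by rw [← hx, ← hw]; exact hmn
  have hyv : y ^ 2 * v ^ 2 = (3 * β) ^ 2 := by rw [← hy, ← hv]; exact hkl
  have hsq : x ^ 2 * (y ^ 2 + 9 * w ^ 2) = (y * z) ^ 2 := by
    linear_combination 9 * hxw - hyv + y ^ 2 * (hz + hw - hx + hy - hv)
  obtain ⟨r, hr⟩ : x ∣ y * z := by
    rw [← Int.pow_dvd_pow_iff two_ne_zero]
    exact ⟨_, hsq.symm⟩
  refine ⟨y, w, z, r, hy0, hw0, hz, ?_, ?_, ?_⟩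
  · refine mul_left_cancel₀ (pow_ne_zero 2 hx0) ?_
    rw [hsq, hr]
    ring
  · have : w ∣ β := by
      rw [← Int.pow_dvd_pow_iff two_ne_zero]
      exact ⟨x ^ 2, by linear_combination -hxw⟩
    have := Int.natAbs_le_of_dvd_ne_zero this hβ0
    omega
  · have : y ∣ 3 * β := by
      rw [← Int.pow_dvd_pow_iff two_ne_zero]
      exact ⟨v ^ 2, by linear_combination -hyv⟩
    have := Int.natAbs_le_of_dvd_ne_zero this (by omega)
    omega

/-- Infinite descent: `1` and `9` are discordant in Euler's sense. -/
theorem eq_zero_of_sq_add_sq_of_sq_add_nine_mul_sq {a b c d : ℤ}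
    (h1 : a ^ 2 + b ^ 2 = c ^ 2) (h2 : a ^ 2 + 9 * b ^ 2 = d ^ 2) : a = 0 ∨ b = 0 := by
  suffices H : ∀ n : ℕ, ∀ a b c d : ℤ, a ≠ 0 → b ≠ 0 → IsCoprime a b → ¬ 3 ∣ a →
      a ^ 2 + b ^ 2 = c ^ 2 → a ^ 2 + 9 * b ^ 2 = d ^ 2 → b.natAbs = n → False by
    by_contra! h
    obtain ⟨a', b', c', d', ha, hb, hcop, h3, h1', h2', -⟩ :=
      exists_primitive_solution h.1 h.2 h1 h2
    exact H _ a' b' c' d' ha hb hcop h3 h1' h2' rfl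
  intro n
  induction n using Nat.strong_induction_on with
  | _ n ih =>
    intro a b c d ha hb hcop h3 h1 h2 hn
    have hc0 : c ≠ 0 := by rintro rfl; have : 0 < a ^ 2 := by positivity
                           nlinarith
    have hd0 : d ≠ 0 := by rintro rfl; have : 0 < a ^ 2 := by positivity
                           nlinarith
    rw [← sq_abs c] at h1
    rw [← sq_abs d] at h2
    rcases Int.even_or_odd b with hbe | hbo
    · obtain ⟨y, w, z, r, hy, hw, e1, e2, hlt, hlt'⟩ := exists_smaller_solution hcop h3 hb hbe
        (abs_pos.2 hc0) (abs_pos.2 hd0) h1 h2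
      obtain ⟨a', b', c', d', ha', hb', hcop', h3', h1', h2', hle⟩ :=
        exists_primitive_solution hy hw e1 e2
      exact ih b'.natAbs (by omega) a' b' c' d' ha' hb' hcop' h3' h1' h2' rfl
    · rcases Int.even_or_odd a with hae | hao
      · exact not_solution_of_odd_right hcop h3 hbo hae (abs_pos.2 hc0) (abs_pos.2 hd0) h1 h2
      · have ha4 := Int.sq_mod_four_eq_one_of_odd hao
        have hb4 := Int.sq_mod_four_eq_one_of_odd hbo
        rcases Int.even_or_odd |c| with ⟨s, hs⟩ | hco
        · rw [hs] at h1
          ring_nf at h1 ha4 hb4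
          omega
        · have := Int.sq_mod_four_eq_one_of_odd hco
          omega

theorem Int.exists_squarefree_mul_sq {P M N : ℤ} (hP : P ≠ 0) (h : P * M = N ^ 2) :
    ∃ d A : ℤ, Squarefree d ∧ P = d * A ^ 2 ∧ d ∣ M := by
  obtain ⟨a, b, hab, ha⟩ := Nat.sq_mul_squarefree P.natAbs
  obtain ⟨d, hd, hPd⟩ : ∃ d : ℤ, Squarefree d ∧ P = d * (b : ℤ) ^ 2 := by
    have hab' : ((b : ℤ) ^ 2 * a) = P.natAbs := by exact_mod_cast hab
    rcases Int.natAbs_eq P with h | h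
    · exact ⟨a, Int.squarefree_natCast.2 ha, by rw [h, ← hab']; ring⟩
    · refine ⟨-a, ?_, by rw [h, ← hab']; ring⟩
      rw [← Int.squarefree_natAbs]
      simpa using ha
  refine ⟨d, b, hd, hPd, ?_⟩
  have hb : (b : ℤ) ≠ 0 := by
    intro h0
    simp [h0] at hPd
    exact hP hPd
  have hd0 : d ≠ 0 := hd.ne_zero
  obtain ⟨N', rfl⟩ : (b : ℤ) ∣ N := by
    rw [← Int.pow_dvd_pow_iff two_ne_zero]
    exact ⟨d * M, by rw [← h, hPd]; ring⟩
  have e : d * M = N' ^ 2 :=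
    mul_left_cancel₀ (pow_ne_zero 2 hb) (by rw [hPd] at h; linear_combination h)
  obtain ⟨k, rfl⟩ : d ∣ N' := (hd.dvd_pow_iff_dvd two_ne_zero).1 ⟨M, e.symm⟩
  exact ⟨k ^ 2, mul_left_cancel₀ hd0 (by rw [e]; ring)⟩

theorem Rat.eq_zero_of_isSquare {u : ℚ} (h0 : IsSquare u) (h1 : IsSquare (u + 1))
    (h9 : IsSquare (u + 9)) : u = 0 := by
  obtain ⟨α, rfl⟩ := h0
  have hq : (α.den : ℚ) ≠ 0 := by exact_mod_cast α.den_ne_zero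
  have hα : α = α.num / α.den := α.num_div_den.symm
  have key (k : ℤ) (hk : IsSquare (α * α + k)) :
      ∃ c : ℤ, α.num ^ 2 + k * (α.den : ℤ) ^ 2 = c ^ 2 := by
    obtain ⟨β, hβ⟩ := hk
    have : IsSquare ((α.num ^ 2 + k * (α.den : ℤ) ^ 2 : ℤ) : ℚ) := by
      refine ⟨β * α.den, ?_⟩
      have : α * α.den = α.num := α.mul_den_eq_num
      push_cast
      rw [← this]
      linear_combination (α.den : ℚ) ^ 2 * hβ
    rw [Rat.isSquare_intCast_iff] at this
    obtain ⟨c, hc⟩ := this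
    exact ⟨c, by rw [hc, sq]⟩
  obtain ⟨c, hc⟩ := key 1 (by exact_mod_cast h1)
  obtain ⟨d, hd⟩ := key 9 (by exact_mod_cast h9)
  rw [one_mul] at hc
  rcases eq_zero_of_sq_add_sq_of_sq_add_nine_mul_sq hc hd with h | h
  · rw [Rat.num_eq_zero] at h
    simp [h]
  · exact absurd (by exact_mod_cast h) hq

theorem isSquare_of_mul_eq_sq {F : Type*} [Field F] {a b c : F} (ha : a ≠ 0) (hsq : IsSquare a)
    (h : a * b = c ^ 2) : IsSquare b := by
  obtain ⟨r, rfl⟩ := hsq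
  have hr : r ≠ 0 := left_ne_zero_of_mul ha
  refine ⟨c / r, ?_⟩
  field_simp
  linear_combination h

theorem Rat.eq_three_of_isSquare {u y : ℚ} (hy : y ^ 2 = u * (u + 1) * (u + 9)) (hy0 : y ≠ 0)
    (h0 : IsSquare (3 * u)) (h1 : IsSquare (u + 1)) (h9 : IsSquare (3 * (u + 9))) : u = 3 := by
  by_contra hu
  have hu' : u - 3 ≠ 0 := sub_ne_zero.2 hu
  have hne : u * (u + 1) * (u + 9) ≠ 0 := hy ▸ pow_ne_zero 2 hy0
  have hu1 : u + 1 ≠ 0 := right_ne_zero_of_mul (left_ne_zero_of_mul hne)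
  have hu0 : u ≠ 0 := left_ne_zero_of_mul (left_ne_zero_of_mul hne)
  have hu9 : u + 9 ≠ 0 := right_ne_zero_of_mul hne
  set l : ℚ := (y - 12) / (u - 3) with hl
  have hly : y = l * (u - 3) + 12 := by rw [hl]; field_simp; ring
  set v : ℚ := l ^ 2 - 13 - u with hv
  have hcub : l ^ 2 * (u - 3) + 24 * l = u ^ 2 + 13 * u + 48 := by
    refine mul_left_cancel₀ hu' ?_
    rw [hly] at hy
    linear_combination hy
  have e0 : 3 * u * v = (12 - 3 * l) ^ 2 := by rw [hv]; linear_combination 3 * hcub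
  have e1 : (u + 1) * (v + 1) = ((12 - 4 * l) / 2) ^ 2 := by rw [hv]; linear_combination hcub
  have e9 : 3 * (u + 9) * (v + 9) = ((12 - 12 * l) / 2) ^ 2 := by
    rw [hv]; linear_combination 3 * hcub
  have hv0 : v = 0 := Rat.eq_zero_of_isSquare (isSquare_of_mul_eq_sq (by positivity) h0 e0)
    (isSquare_of_mul_eq_sq hu1 h1 e1) (isSquare_of_mul_eq_sq (by simpa using hu9) h9 e9)
  rw [hv0, mul_zero] at e0
  have hl4 : l = 4 := by
    have := pow_eq_zero_iff two_ne_zero |>.1 e0.symm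
    linarith
  rw [hl4] at hcub
  exact mul_ne_zero hu0 hu' (by linear_combination -hcub)

theorem Int.squarefree_dvd_nine {d : ℤ} (hd : Squarefree d) (h : d ∣ 9) :
    d = 1 ∨ d = -1 ∨ d = 3 ∨ d = -3 := by
  have h3 : d ∣ 3 := (hd.dvd_pow_iff_dvd two_ne_zero).1 (by simpa using h)
  have hle := Int.le_of_dvd (by norm_num) h3
  have hle' : -3 ≤ d := neg_le.1 (Int.le_of_dvd (by norm_num) (neg_dvd.2 h3))
  have h0 : d ≠ 0 := hd.ne_zero
  interval_cases d <;> simp_all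

theorem Int.squarefree_dvd_eight {d : ℤ} (hd : Squarefree d) (h : d ∣ 8) :
    d = 1 ∨ d = -1 ∨ d = 2 ∨ d = -2 := by
  have h3 : d ∣ 2 := (hd.dvd_pow_iff_dvd three_ne_zero).1 (by simpa using h)
  have hle := Int.le_of_dvd (by norm_num) h3
  have hle' : -2 ≤ d := neg_le.1 (Int.le_of_dvd (by norm_num) (neg_dvd.2 h3))
  have h0 : d ≠ 0 := hd.ne_zero
  interval_cases d <;> omega

/-- The result of a complete 2-descent, before local conditions are imposed. -/
theorem exists_descent_data {u y : ℚ} (hy : y ^ 2 = u * (u + 1) * (u + 9)) (hy0 : y ≠ 0) :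
    ∃ d₁ d₂ A B C e : ℤ, (d₁ = 1 ∨ d₁ = -1 ∨ d₁ = 3 ∨ d₁ = -3) ∧
      (d₂ = 1 ∨ d₂ = -1 ∨ d₂ = 2 ∨ d₂ = -2) ∧ A ≠ 0 ∧ B ≠ 0 ∧ C ≠ 0 ∧ e ≠ 0 ∧ IsCoprime A e ∧
      u * e ^ 2 = d₁ * A ^ 2 ∧ d₁ * A ^ 2 + e ^ 2 = d₂ * B ^ 2 ∧
      d₁ * d₂ * (d₁ * A ^ 2 + 9 * e ^ 2) = C ^ 2 := by
  have hne : u * (u + 1) * (u + 9) ≠ 0 := hy ▸ pow_ne_zero 2 hy0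
  obtain ⟨p, q, hq, hcop, rfl⟩ : ∃ p q : ℤ, 0 < q ∧ IsCoprime p q ∧ u = p / q :=
    ⟨u.num, u.den, by exact_mod_cast u.den_pos,
      Int.isCoprime_iff_gcd_eq_one.2 u.reduced, u.num_div_den.symm⟩
  have hq0 : (q : ℚ) ≠ 0 := by exact_mod_cast hq.ne'
  have hN : ∃ N : ℤ, p * (p + q) * (p + 9 * q) * q = N ^ 2 := by
    have : IsSquare ((p * (p + q) * (p + 9 * q) * q : ℤ) : ℚ) := by
      refine ⟨y * q ^ 2, ?_⟩
      have : y * q ^ 2 * (y * q ^ 2) = y ^ 2 * q ^ 4 := by ring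
      rw [this, hy]
      push_cast
      field_simp
    obtain ⟨N, hN⟩ := Rat.isSquare_intCast_iff.1 this
    exact ⟨N, by rw [hN, sq]⟩
  obtain ⟨N, hN⟩ := hN
  have hp : p ≠ 0 := by rintro rfl; simp at hne
  have hpq : p + q ≠ 0 := by
    intro h
    have : (p : ℚ) = -q := by exact_mod_cast eq_neg_of_add_eq_zero_left h
    apply hne
    rw [this]
    field_simp
    ring
  have hp9 : p + 9 * q ≠ 0 := by
    intro h
    have : (p : ℚ) = -(9 * q) := by exact_mod_cast eq_neg_of_add_eq_zero_left h
    apply hne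
    rw [this]
    field_simp
    ring
  have c1 : IsCoprime (p + q) q := by simpa using (IsCoprime.add_mul_left_left hcop 1)
  have c9 : IsCoprime (p + 9 * q) q := IsCoprime.add_mul_right_left hcop 9
  obtain ⟨e, rfl⟩ := Int.exists_eq_sq_of_isCoprime_of_pos
    ((hcop.mul_left c1).mul_left c9).symm hq (by rw [mul_comm]; exact hN)
  have he : e ≠ 0 := by rintro rfl; simp at hq
  obtain ⟨d₁, A, hd₁, hA, hdvd₁⟩ := Int.exists_squarefree_mul_sq hp
    (M := (p + e ^ 2) * (p + 9 * e ^ 2) * e ^ 2) (by rw [← hN]; ring)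
  obtain ⟨d₂, B, hd₂, hB, hdvd₂⟩ := Int.exists_squarefree_mul_sq hpq
    (M := p * (p + 9 * e ^ 2) * e ^ 2) (by rw [← hN]; ring)
  have k₁ : d₁ ∣ p := ⟨_, hA⟩
  have k₂ : d₂ ∣ p + e ^ 2 := ⟨_, hB⟩
  have h9 : d₁ ∣ 9 := by
    have : IsCoprime d₁ ((e ^ 2) ^ 3) := (hcop.of_isCoprime_of_dvd_left k₁).pow_right
    refine this.dvd_of_dvd_mul_right ?_
    have := dvd_sub hdvd₁ (k₁.mul_right ((p + 10 * e ^ 2) * e ^ 2))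
    ring_nf at this ⊢
    exact this
  have h8 : d₂ ∣ 8 := by
    have : IsCoprime d₂ ((e ^ 2) ^ 3) := (c1.of_isCoprime_of_dvd_left k₂).pow_right
    refine this.dvd_of_dvd_mul_right ?_
    have := dvd_sub (k₂.mul_right ((p + 8 * e ^ 2) * e ^ 2)) hdvd₂
    ring_nf at this ⊢
    exact this
  have hA0 : A ≠ 0 := by rintro rfl; simp at hA; exact hp hA
  have hB0 : B ≠ 0 := by rintro rfl; simp at hB; exact hpq hB
  obtain ⟨C, rfl⟩ : A * B * e ∣ N := by
    rw [← Int.pow_dvd_pow_iff two_ne_zero]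
    refine ⟨d₁ * d₂ * (p + 9 * e ^ 2), ?_⟩
    rw [← hN, hB]
    linear_combination (p + 9 * e ^ 2) * e ^ 2 * d₂ * B ^ 2 * hA
  have hABe : A * B * e ≠ 0 := mul_ne_zero (mul_ne_zero hA0 hB0) he
  have hC : d₁ * d₂ * (d₁ * A ^ 2 + 9 * e ^ 2) = C ^ 2 := by
    refine mul_left_cancel₀ (pow_ne_zero 2 hABe) ?_
    rw [← hA, ← mul_pow, ← hN, hB]
    linear_combination -(p + 9 * e ^ 2) * e ^ 2 * d₂ * B ^ 2 * hA
  refine ⟨d₁, d₂, A, B, C, e, Int.squarefree_dvd_nine hd₁ h9, Int.squarefree_dvd_eight hd₂ h8,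
    hA0, hB0, ?_, he, ?_, ?_, ?_, hC⟩
  · rintro rfl
    rw [← hA] at hC
    simp [hd₁.ne_zero, hd₂.ne_zero, hp9] at hC
  · rw [hA] at hcop
    exact (IsCoprime.pow_iff two_pos two_pos).1 hcop.of_mul_left_right
  · have : (p : ℚ) = d₁ * A ^ 2 := by exact_mod_cast hA
    rw [← this]
    push_cast at hq0 ⊢
    field_simp
  · rw [← hA, hB]

theorem IsCoprime.not_three_dvd {a b : ℤ} (h : IsCoprime a b) (ha : 3 ∣ a) (hb : 3 ∣ b) :
    False := by
  have := h.isUnit_of_dvd' ha hb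
  rw [Int.isUnit_iff] at this
  omega

theorem Int.three_dvd_of_sq_eq {a m : ℤ} (h : a ^ 2 = 3 * m) : 3 ∣ a :=
  Int.prime_three.dvd_of_dvd_pow ⟨m, h⟩

/-- The class of a rational point modulo squares agrees with that of a torsion point. -/
theorem isSquare_classes {u y : ℚ} (hy : y ^ 2 = u * (u + 1) * (u + 9)) (hy0 : y ≠ 0) :
    ∃ d₁ d₂ : ℚ, (d₁ = 1 ∧ d₂ = 1 ∨ d₁ = 3 ∧ d₂ = 1 ∨ d₁ = -1 ∧ d₂ = -2 ∨ d₁ = -3 ∧ d₂ = -2) ∧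
      IsSquare (d₁ * u) ∧ IsSquare (d₂ * (u + 1)) ∧ IsSquare (d₁ * d₂ * (u + 9)) := by
  obtain ⟨d₁, d₂, A, B, C, e, hd₁, hd₂, hA, hB, hC, he, hcop, hu, h1, h9⟩ :=
    exists_descent_data hy hy0
  have he' : (e : ℚ) ≠ 0 := by exact_mod_cast he
  have h1' : (d₁ * A ^ 2 + e ^ 2 : ℚ) = d₂ * B ^ 2 := by exact_mod_cast h1
  have h9' : (d₁ * d₂ * (d₁ * A ^ 2 + 9 * e ^ 2) : ℚ) = C ^ 2 := by exact_mod_cast h9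
  refine ⟨d₁, d₂, ?_, ⟨d₁ * A / e, ?_⟩, ⟨d₂ * B / e, ?_⟩, ⟨C / e, ?_⟩⟩
  · have hA2 : 0 < A ^ 2 := by positivity
    have hB2 : 0 < B ^ 2 := by positivity
    have hC2 : 0 < C ^ 2 := by positivity
    have he2 : 0 < e ^ 2 := by positivity
    rcases hd₁ with rfl | rfl | rfl | rfl <;> rcases hd₂ with rfl | rfl | rfl | rfl <;>
      try norm_num
    · linarith
    · obtain ⟨-, hA3⟩ := Int.three_dvd_of_dvd_sq_add_sq (a := C) (b := A)
        ⟨A ^ 2 + 6 * e ^ 2, by linear_combination -h9⟩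
      obtain ⟨he3, -⟩ := Int.three_dvd_of_dvd_sq_add_sq (a := e) (b := B)
        (by obtain ⟨k, rfl⟩ := hA3; exact ⟨B ^ 2 - 3 * k ^ 2, by linear_combination h1⟩)
      exact hcop.not_three_dvd hA3 he3
    · linarith
    · linarith
    · obtain ⟨-, hA3⟩ := Int.three_dvd_of_dvd_sq_add_sq (a := C) (b := A)
        ⟨3 * e ^ 2, by linear_combination -h9⟩
      obtain ⟨he3, -⟩ := Int.three_dvd_of_dvd_sq_add_sq (a := e) (b := B)
        (by obtain ⟨k, rfl⟩ := hA3; exact ⟨3 * k ^ 2, by linear_combination h1⟩)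
      exact hcop.not_three_dvd hA3 he3
    · linarith
    · linarith
    · obtain ⟨he3, ⟨k, rfl⟩⟩ := Int.three_dvd_of_dvd_sq_add_sq (a := e) (b := B)
        ⟨B ^ 2 - A ^ 2, by linear_combination h1⟩
      refine hcop.not_three_dvd ?_ he3
      obtain ⟨j, rfl⟩ := he3
      exact Int.three_dvd_of_sq_eq (m := 2 * k ^ 2 - j ^ 2) (by linarith)
    · linarith
    · linarith
    · obtain ⟨he3, ⟨k, rfl⟩⟩ := Int.three_dvd_of_dvd_sq_add_sq (a := e) (b := B)
        ⟨A ^ 2, by linear_combination h1⟩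
      refine hcop.not_three_dvd ?_ he3
      obtain ⟨j, rfl⟩ := he3
      exact Int.three_dvd_of_sq_eq (m := k ^ 2 + j ^ 2) (by linarith)
    · linarith
  · field_simp
    linear_combination (d₁ : ℚ) * hu
  · field_simp
    linear_combination (d₂ : ℚ) * (hu + h1')
  · field_simp
    linear_combination d₁ * d₂ * hu + h9'

theorem u_eq_of_sq_eq {u y : ℚ} (hy : y ^ 2 = u * (u + 1) * (u + 9)) :
    u = 0 ∨ u = -1 ∨ u = -9 ∨ u = 3 ∨ u = -3 := by
  by_cases hy0 : y = 0
  · rw [hy0] at hy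
    have : u * (u + 1) * (u + 9) = 0 := by linarith
    rcases mul_eq_zero.1 this with h | h
    · rcases mul_eq_zero.1 h with h | h
      · exact Or.inl h
      · exact Or.inr (Or.inl (by linarith))
    · exact Or.inr (Or.inr (Or.inl (by linarith)))
  · have hne : u * (u + 1) * (u + 9) ≠ 0 := hy ▸ pow_ne_zero 2 hy0
    have hu1 : u + 1 ≠ 0 := right_ne_zero_of_mul (left_ne_zero_of_mul hne)
    obtain ⟨d₁, d₂, hd, h0, h1, h9⟩ := isSquare_classes hy hy0
    have hy' : (8 * y / (u + 1) ^ 2) ^ 2 =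
        -(u + 9) / (u + 1) * (-(u + 9) / (u + 1) + 1) * (-(u + 9) / (u + 1) + 9) := by
      field_simp
      rw [hy]
      ring
    have hy0' : 8 * y / (u + 1) ^ 2 ≠ 0 := by positivity
    have e1 : -(u + 9) / (u + 1) + 1 = -2 * (u + 1) * (2 / (u + 1)) ^ 2 := by field_simp; ring
    have s1 (h : IsSquare (-2 * (u + 1))) : IsSquare (-(u + 9) / (u + 1) + 1) :=
      e1 ▸ h.mul (IsSquare.sq _)
    rcases hd with ⟨rfl, rfl⟩ | ⟨rfl, rfl⟩ | ⟨rfl, rfl⟩ | ⟨rfl, rfl⟩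
    · simp only [one_mul] at h0 h1 h9
      exact Or.inl (Rat.eq_zero_of_isSquare h0 h1 h9)
    · rw [one_mul] at h1
      rw [mul_one] at h9
      exact Or.inr (Or.inr (Or.inr (Or.inl (Rat.eq_three_of_isSquare hy hy0 h0 h1 h9))))
    · have e0 : -(u + 9) / (u + 1) =
          (-1 * -2 * (u + 9)) * (-2 * (u + 1)) * (1 / (2 * (u + 1))) ^ 2 := by field_simp
      have e9 : -(u + 9) / (u + 1) + 9 =
          (-1 * u) * (-2 * (u + 1)) * (2 / (u + 1)) ^ 2 := by field_simp; ring
      have := Rat.eq_zero_of_isSquare (e0 ▸ (h9.mul h1).mul (IsSquare.sq _)) (s1 h1)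
        (e9 ▸ (h0.mul h1).mul (IsSquare.sq _))
      rw [this] at hy'
      norm_num at hy'
      simp_all
    · have e0 : 3 * (-(u + 9) / (u + 1)) =
          (-3 * -2 * (u + 9)) * (-2 * (u + 1)) * (1 / (2 * (u + 1))) ^ 2 := by field_simp
      have e9 : 3 * (-(u + 9) / (u + 1) + 9) =
          (-3 * u) * (-2 * (u + 1)) * (2 / (u + 1)) ^ 2 := by field_simp; ring
      have := Rat.eq_three_of_isSquare hy' hy0' (e0 ▸ (h9.mul h1).mul (IsSquare.sq _)) (s1 h1)
        (e9 ▸ (h0.mul h1).mul (IsSquare.sq _))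
      rw [div_eq_iff hu1] at this
      exact Or.inr (Or.inr (Or.inr (Or.inr (by linarith))))

open WeierstrassCurve

namespace curveE

/-- The affine point `(x, y)` of `curveE`. -/
def pt (x y : ℚ) (h : y ^ 2 = x * (x - 8) * (x - 9)) : curveE.toAffine.Point :=
  .some x y (Affine.equation_iff_nonsingular.1 ((curveE_equation x y).2 h))

theorem pt_congr {x y x' y' : ℚ} {h : y ^ 2 = x * (x - 8) * (x - 9)} (hx : x = x') (hy : y = y') :
    pt x y h = pt x' y' (hx ▸ hy ▸ h) := by
  subst hx hy
  rfl

theorem pt_ne_zero {x y : ℚ} (h : y ^ 2 = x * (x - 8) * (x - 9)) : pt x y h ≠ 0 :=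
  Affine.Point.some_ne_zero _

theorem exists_eq_pt {P : curveE.toAffine.Point} (hP : P ≠ 0) : ∃ x y h, P = pt x y h := by
  rcases P with _ | ⟨x, y, h⟩
  · exact absurd rfl hP
  · exact ⟨x, y, (curveE_equation x y).1 h.1, rfl⟩

theorem pt_add_pt {x₁ y₁ x₂ y₂ x₃ y₃ l : ℚ} {h₁ : y₁ ^ 2 = x₁ * (x₁ - 8) * (x₁ - 9)}
    {h₂ : y₂ ^ 2 = x₂ * (x₂ - 8) * (x₂ - 9)} (h₃ : y₃ ^ 2 = x₃ * (x₃ - 8) * (x₃ - 9))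
    (hx : x₁ ≠ x₂) (hl : l = (y₁ - y₂) / (x₁ - x₂)) (hx₃ : x₃ = l ^ 2 + 17 - x₁ - x₂)
    (hy₃ : y₃ = -(l * (x₃ - x₁) + y₁)) : pt x₁ y₁ h₁ + pt x₂ y₂ h₂ = pt x₃ y₃ h₃ := by
  rw [pt, pt, Affine.Point.add_of_X_ne hx]
  subst hl hx₃ hy₃
  simp [pt, Affine.addX, Affine.addY, Affine.negAddY, Affine.negY, Affine.slope_of_X_ne hx, curveE]

theorem pt_add_self {x₁ y₁ x₃ y₃ l : ℚ} {h₁ : y₁ ^ 2 = x₁ * (x₁ - 8) * (x₁ - 9)}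
    (h₃ : y₃ ^ 2 = x₃ * (x₃ - 8) * (x₃ - 9)) (hy : y₁ ≠ 0)
    (hl : l = (3 * x₁ ^ 2 - 34 * x₁ + 72) / (2 * y₁)) (hx₃ : x₃ = l ^ 2 + 17 - 2 * x₁)
    (hy₃ : y₃ = -(l * (x₃ - x₁) + y₁)) : pt x₁ y₁ h₁ + pt x₁ y₁ h₁ = pt x₃ y₃ h₃ := by
  have hy' : y₁ ≠ curveE.toAffine.negY x₁ y₁ := by
    simp only [Affine.negY, curveE]
    contrapose! hy
    linarith
  rw [pt, Affine.Point.add_self_of_Y_ne hy']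
  have hs : curveE.toAffine.slope x₁ x₁ y₁ y₁ = l := by
    rw [Affine.slope_of_Y_ne rfl hy', hl]
    simp only [Affine.negY, curveE]
    congr 1 <;> ring
  have e1 : curveE.toAffine.addX x₁ x₁ l = x₃ := by
    rw [hx₃]
    simp only [Affine.addX, curveE]
    ring
  have e2 : curveE.toAffine.addY x₁ x₁ y₁ l = y₃ := by
    rw [hy₃, Affine.addY, Affine.negAddY, e1]
    simp only [Affine.negY, curveE]
    ring
  simp only [pt, Affine.Point.some.injEq, hs]
  exact ⟨e1, e2⟩

theorem pt_add_neg {x y y' : ℚ} {h : y ^ 2 = x * (x - 8) * (x - 9)}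
    {h' : y' ^ 2 = x * (x - 8) * (x - 9)} (hy : y = -y') : pt x y h + pt x y' h' = 0 :=
  Affine.Point.add_of_Y_eq rfl (by simp [Affine.negY, curveE, hy])

/-- A point of order two. -/
def T : curveE.toAffine.Point := pt 0 0 (by norm_num)

/-- A point of order four. -/
def P : curveE.toAffine.Point := pt 12 12 (by norm_num)

theorem two_T : 2 • T = 0 := by
  rw [two_nsmul]
  exact pt_add_neg (by norm_num)

theorem two_P : 2 • P = pt 9 0 (by norm_num) := by
  rw [two_nsmul]
  exact pt_add_self (l := 4) _ (by norm_num) (by norm_num) (by norm_num) (by norm_num)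

theorem three_P : 3 • P = pt 12 (-12) (by norm_num) := by
  rw [succ_nsmul, two_P]
  exact pt_add_pt (l := 4) _ (by norm_num) (by norm_num) (by norm_num) (by norm_num)

theorem four_P : 4 • P = 0 := by
  rw [succ_nsmul, three_P]
  exact pt_add_neg (by norm_num)

theorem T_add_P : T + P = pt 6 (-6) (by norm_num) :=
  pt_add_pt (l := 1) _ (by norm_num) (by norm_num) (by norm_num) (by norm_num)

theorem T_add_two_P : T + 2 • P = pt 8 0 (by norm_num) := by
  rw [two_P]
  exact pt_add_pt (l := 0) _ (by norm_num) (by norm_num) (by norm_num) (by norm_num)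

theorem T_add_three_P : T + 3 • P = pt 6 6 (by norm_num) := by
  rw [three_P]
  exact pt_add_pt (l := -1) _ (by norm_num) (by norm_num) (by norm_num) (by norm_num)

theorem exists_eq_smul (Q : curveE.toAffine.Point) :
    ∃ i j : ℕ, Q = i • T + j • P := by
  by_cases hQ : Q = 0
  · exact ⟨0, 0, by simp [hQ]⟩
  obtain ⟨x, y, h, rfl⟩ := exists_eq_pt hQ
  have hu := u_eq_of_sq_eq (u := x - 9) (y := y) (by rw [h]; ring)
  have hx : x = 9 ∨ x = 8 ∨ x = 0 ∨ x = 12 ∨ x = 6 := by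
    rcases hu with h | h | h | h | h
    · exact Or.inl (by linarith)
    · exact Or.inr (Or.inl (by linarith))
    · exact Or.inr (Or.inr (Or.inl (by linarith)))
    · exact Or.inr (Or.inr (Or.inr (Or.inl (by linarith))))
    · exact Or.inr (Or.inr (Or.inr (Or.inr (by linarith))))
  rcases hx with rfl | rfl | rfl | rfl | rfl
  · exact ⟨0, 2, by rw [zero_nsmul, zero_add, two_P]; exact pt_congr rfl (by simpa using h)⟩
  · exact ⟨1, 2, by rw [one_nsmul, T_add_two_P]; exact pt_congr rfl (by simpa using h)⟩
  · exact ⟨1, 0, by rw [one_nsmul, zero_nsmul, add_zero]; exact pt_congr rfl (by simpa using h)⟩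
  · rcases sq_eq_sq_iff_eq_or_eq_neg.1 (h.trans (by norm_num : _ = (12 : ℚ) ^ 2)) with h | h
    · exact ⟨0, 1, by rw [zero_nsmul, zero_add, one_nsmul]; exact pt_congr rfl h⟩
    · exact ⟨0, 3, by rw [zero_nsmul, zero_add, three_P]; exact pt_congr rfl h⟩
  · rcases sq_eq_sq_iff_eq_or_eq_neg.1 (h.trans (by norm_num : _ = (6 : ℚ) ^ 2)) with h | h
    · exact ⟨1, 3, by rw [one_nsmul, T_add_three_P]; exact pt_congr rfl h⟩
    · exact ⟨1, 1, by rw [one_nsmul, one_nsmul, T_add_P]; exact pt_congr rfl h⟩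

/-- The homomorphism `(i, j) ↦ i • T + j • P`. -/
noncomputable def torsionHom : ZMod 2 × ZMod 4 →+ curveE.toAffine.Point :=
  (ZMod.lift 2 ⟨zmultiplesHom _ T, (natCast_zsmul T 2).trans two_T⟩).coprod
    (ZMod.lift 4 ⟨zmultiplesHom _ P, (natCast_zsmul P 4).trans four_P⟩)

theorem torsionHom_natCast (i j : ℕ) : torsionHom (i, j) = i • T + j • P := by
  have h2 := ZMod.lift_coe 2 ⟨zmultiplesHom _ T, (natCast_zsmul T 2).trans two_T⟩ i
  have h4 := ZMod.lift_coe 4 ⟨zmultiplesHom _ P, (natCast_zsmul P 4).trans four_P⟩ j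
  rw [Int.cast_natCast] at h2 h4
  rw [torsionHom, AddMonoidHom.coprod_apply, h2, h4]
  simp

theorem torsionHom_bijective : Function.Bijective torsionHom := by
  constructor
  · rw [injective_iff_map_eq_zero]
    rintro ⟨i, j⟩ h
    obtain ⟨i, hi, rfl⟩ : ∃ k : ℕ, k < 2 ∧ (k : ZMod 2) = i :=
      ⟨i.val, i.val_lt, ZMod.natCast_zmod_val i⟩
    obtain ⟨j, hj, rfl⟩ : ∃ k : ℕ, k < 4 ∧ (k : ZMod 4) = j :=
      ⟨j.val, j.val_lt, ZMod.natCast_zmod_val j⟩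
    rw [torsionHom_natCast] at h
    interval_cases i <;> interval_cases j <;>
      simp only [zero_nsmul, one_nsmul, zero_add, add_zero, T_add_two_P, T_add_three_P,
        T_add_P] at h
    · rfl
    · exact absurd h (pt_ne_zero _)
    · exact absurd (two_P.symm.trans h) (pt_ne_zero _)
    · exact absurd (three_P.symm.trans h) (pt_ne_zero _)
    all_goals exact absurd h (pt_ne_zero _)
  · intro Q
    obtain ⟨i, j, h⟩ := exists_eq_smul Q
    exact ⟨(i, j), by rw [torsionHom_natCast, h]⟩

/-- The Mordell-Weil group of `curveE`. -/
noncomputable def pointEquiv : ZMod 2 × ZMod 4 ≃+ curveE.toAffine.Point :=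
  AddEquiv.ofBijective torsionHom torsionHom_bijective

instance : Finite curveE.toAffine.Point := Finite.of_equiv _ pointEquiv.toEquiv

end curveE

theorem curveE_points : Module.Finite ℤ curveE.toAffine.Point ∧
      Module.finrank ℤ curveE.toAffine.Point = 0 ∧
      Nonempty (AddCommGroup.torsion curveE.toAffine.Point ≃+ ZMod 2 × ZMod 4) := by
  refine ⟨inferInstance, ?_, ?_⟩
  · exact Module.finrank_eq_zero_of_rank_eq_zero (rank_eq_zero_iff.2 fun x ↦
      ⟨Nat.card curveE.toAffine.Point, by exact_mod_cast Nat.card_pos.ne', by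
        simp⟩)
  · have h : AddCommGroup.torsion curveE.toAffine.Point = ⊤ :=
      AddCommGroup.torsion_eq_top_iff.2 isAddTorsion_of_finite
    exact ⟨((AddEquiv.addSubgroupCongr h).trans AddSubgroup.topEquiv).trans
      curveE.pointEquiv.symm⟩

open IsDiscreteValuationRing

section DVR

variable {R : Type*} [CommRing R] [IsDomain R] [IsDiscreteValuationRing R]

theorem Irreducible.pow_dvd_of_le_addVal {ϖ a : R} (h : Irreducible ϖ) {m : ℕ∞}
    (hm : m ≤ addVal R a) (n : ℕ) (hn : (n : ℕ∞) ≤ m) : ϖ ^ n ∣ a := by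
  rw [← addVal_le_iff_dvd, h.addVal_pow]
  exact hn.trans hm

theorem Irreducible.not_pow_dvd_of_addVal_eq {ϖ a : R} (h : Irreducible ϖ) {m : ℕ∞}
    (hm : addVal R a = m) (n : ℕ) (hn : m < n) : ¬ ϖ ^ n ∣ a := by
  rw [← addVal_le_iff_dvd, h.addVal_pow, hm]
  exact hn.not_ge

theorem addVal_isUnit_mul {u : R} (hu : IsUnit u) (a : R) : addVal R (u * a) = addVal R a := by
  rw [addVal_mul, addVal_eq_zero_iff.2 hu, zero_add]

end DVR

namespace WeierstrassCurve

section Models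

variable {R : Type*} [CommRing R] [IsDomain R] [IsDiscreteValuationRing R]
  {K : Type*} [Field K] [Algebra R K] [IsFractionRing R K]

open IsDedekindDomain.HeightOneSpectrum

theorem exists_algebraMap_eq_inv_u {V V' : WeierstrassCurve R} {C : VariableChange K}
    (h : C • V.baseChange K = V'.baseChange K) (hV : addVal R V.Δ < 12) :
    ∃ b : R, algebraMap R K b = (C.u⁻¹ : Kˣ) := by
  rcases ValuationRing.isInteger_or_isInteger R (C.u : K) with ⟨a, ha⟩ | ⟨b, hb⟩
  · have hΔ : a ^ 12 * V'.Δ = V.Δ := by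
      apply IsFractionRing.injective R K
      have := congrArg Δ h
      rw [variableChange_Δ, baseChange, baseChange, map_Δ, map_Δ] at this
      rw [map_mul, map_pow, ha, ← this, ← mul_assoc, ← mul_pow, C.u.mul_inv, one_pow, one_mul]
    have hu : IsUnit a := by
      by_contra hu
      obtain ⟨ϖ, hϖ⟩ := exists_irreducible R
      have : ϖ ∣ a := by
        rw [← Ideal.mem_span_singleton, ← hϖ.maximalIdeal_eq]
        exact hu
      have : ϖ ^ 12 ∣ V.Δ := hΔ ▸ (pow_dvd_pow_of_dvd this 12).mul_right _
      exact hϖ.not_pow_dvd_of_addVal_eq rfl 12 hV this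
    obtain ⟨a, rfl⟩ := hu
    refine ⟨(a⁻¹ : Rˣ), ?_⟩
    rw [Units.val_inv_eq_inv_val, ← ha, map_units_inv]
  · exact ⟨b, by rw [hb, Units.val_inv_eq_inv_val]⟩

theorem Δ_dvd_Δ {V V' : WeierstrassCurve R} {C : VariableChange K}
    (h : C • V.baseChange K = V'.baseChange K) (hV : addVal R V.Δ < 12) : V.Δ ∣ V'.Δ := by
  obtain ⟨b, hb⟩ := exists_algebraMap_eq_inv_u h hV
  refine ⟨b ^ 12, ?_⟩
  apply IsFractionRing.injective R K
  have := congrArg Δ h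
  rw [variableChange_Δ, baseChange, baseChange, map_Δ, map_Δ] at this
  rw [map_mul, map_pow, hb, ← this, mul_comm]

instance (V : WeierstrassCurve R) : IsIntegral R (V.baseChange K) := ⟨V, rfl⟩

theorem isMinimal_of_addVal_Δ_lt {V : WeierstrassCurve R} (hV : addVal R V.Δ < 12) :
    IsMinimal R (V.baseChange K) := by
  refine ⟨⟨by simp only [one_smul]; infer_instance, fun C hC _ ↦ ?_⟩⟩
  obtain ⟨V', hV'⟩ := hC.integral
  dsimp only
  rw [one_smul, hV', ← Subtype.coe_le_coe, valuation_Δ_aux_eq_of_isIntegral,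
    valuation_Δ_aux_eq_of_isIntegral, baseChange, baseChange, map_Δ, map_Δ]
  obtain ⟨c, hc⟩ := Δ_dvd_Δ hV' hV
  rw [hc, map_mul, map_mul]
  exact mul_le_of_le_one_right' (valuation_le_one _ _)

theorem Δ_dvd_Δ_of_isMinimal {V V' : WeierstrassCurve R} {C : VariableChange K}
    (h : C • V.baseChange K = V'.baseChange K) (hV' : IsMinimal R (V'.baseChange K))
    (hΔ : V.Δ ≠ 0) : V'.Δ ∣ V.Δ := by
  have hC : C⁻¹ • V'.baseChange K = V.baseChange K := by rw [← h, inv_smul_smul]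
  have hle := hV'.val_Δ_maximal.le (j := C⁻¹) (by simp only [hC]; infer_instance)
  rw [hC, one_smul, ← Subtype.coe_le_coe, valuation_Δ_aux_eq_of_isIntegral,
    valuation_Δ_aux_eq_of_isIntegral, baseChange, baseChange, map_Δ, map_Δ] at hle
  have hV'0 : algebraMap R K V'.Δ ≠ 0 := by
    have := congrArg Δ h
    rw [variableChange_Δ, baseChange, baseChange, map_Δ, map_Δ] at this
    rw [← this]
    exact mul_ne_zero (pow_ne_zero _ C.u⁻¹.ne_zero)
      (by rwa [Ne, FaithfulSMul.algebraMap_eq_zero_iff])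
  obtain ⟨c, hc⟩ := exists_lift_of_le_one (A := R) (x := algebraMap R K V.Δ / algebraMap R K V'.Δ)
    (by
      rw [map_div₀]
      exact div_le_one_of_le₀ hle zero_le)
  refine ⟨c, ?_⟩
  apply IsFractionRing.injective R K
  rw [map_mul, hc, mul_div_cancel₀ _ hV'0]

theorem exists_variableChange_eq_map {V V' : WeierstrassCurve R} {C : VariableChange K}
    (h : C • V.baseChange K = V'.baseChange K) (hV : addVal R V.Δ < 12)
    (hV' : addVal R V'.Δ < 12) : ∃ C' : VariableChange R, C' • V = V' := by
  have hC : C⁻¹ • V'.baseChange K = V.baseChange K := by rw [← h, inv_smul_smul]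
  obtain ⟨b, hb⟩ := exists_algebraMap_eq_inv_u h hV
  obtain ⟨a, ha⟩ := exists_algebraMap_eq_inv_u hC hV'
  replace ha : algebraMap R K a = C.u := by simpa [VariableChange.inv_def] using ha
  have hab : a * b = 1 := by
    apply IsFractionRing.injective R K
    rw [map_mul, ha, hb, map_one, C.u.mul_inv]
  have hua (x y : K) (n : ℕ) (e : ((C.u⁻¹ : Kˣ) : K) ^ n * x = y) :
      x = algebraMap R K a ^ n * y := by
    rw [← e, ha, ← mul_assoc, ← mul_pow, C.u.mul_inv, one_pow, one_mul]
  have h6 := hua _ _ _ ((variableChange_b₆ (V.baseChange K) C).symm.trans (congrArg b₆ h))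
  have h8 := hua _ _ _ ((variableChange_b₈ (V.baseChange K) C).symm.trans (congrArg b₈ h))
  have h2 := hua _ _ _ ((variableChange_a₂ (V.baseChange K) C).symm.trans (congrArg a₂ h))
  have ha6 := hua _ _ _ ((variableChange_a₆ (V.baseChange K) C).symm.trans (congrArg a₆ h))
  simp only [baseChange, map_b₂, map_b₄, map_b₆, map_b₈, map_a₁, map_a₂, map_a₃, map_a₄,
    map_a₆] at h6 h8 h2 ha6
  have quartic (x : K) (c₂ c₁ c₀ : R) (e : x ^ 4 + algebraMap R K c₂ * x ^ 2 +
      algebraMap R K c₁ * x + algebraMap R K c₀ = 0) : ∃ y, algebraMap R K y = x := by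
    rw [← IsIntegrallyClosed.isIntegral_iff]
    refine ⟨.X ^ 4 + .C c₂ * .X ^ 2 + .C c₁ * .X + .C c₀, by monicity!, by simpa using e⟩
  have quadratic (x : K) (c₁ c₀ : R) (e : x ^ 2 +
      algebraMap R K c₁ * x + algebraMap R K c₀ = 0) : ∃ y, algebraMap R K y = x := by
    rw [← IsIntegrallyClosed.isIntegral_iff]
    refine ⟨.X ^ 2 + .C c₁ * .X + .C c₀, by monicity!, by simpa using e⟩
  obtain ⟨r, hr⟩ := quartic C.r (-V.b₄) (-(2 * V.b₆ + a ^ 6 * V'.b₆))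
    (-(V.b₈ - a ^ 8 * V'.b₈)) (by
        simp only [map_neg, map_add, map_sub, map_mul, map_pow, map_ofNat]
        linear_combination C.r * h6 - h8)
  rw [← hr] at h2 ha6
  obtain ⟨s, hs⟩ := quadratic C.s V.a₁ (-(V.a₂ + 3 * r - a ^ 2 * V'.a₂))
    (by
        simp only [map_neg, map_add, map_sub, map_mul, map_pow, map_ofNat]
        linear_combination -h2)
  obtain ⟨t, ht⟩ := quadratic C.t (V.a₃ + r * V.a₁)
    (-(V.a₆ + r * V.a₄ + r ^ 2 * V.a₂ + r ^ 3 - a ^ 6 * V'.a₆))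
    (by
        simp only [map_neg, map_add, map_sub, map_mul, map_pow]
        linear_combination -ha6)
  refine ⟨⟨⟨a, b, hab, by rw [mul_comm, hab]⟩, r, s, t⟩, ?_⟩
  apply map_injective (IsFractionRing.injective R K)
  dsimp only
  rw [← map_variableChange]
  refine Eq.trans ?_ h
  congr 1
  ext
  · exact ha
  · exact hr
  · exact hs
  · exact ht

theorem addVal_Δ_variableChange (V : WeierstrassCurve R) (C : VariableChange R) :
    addVal R (C • V).Δ = addVal R V.Δ := by
  rw [variableChange_Δ]
  exact addVal_isUnit_mul (C.u⁻¹.isUnit.pow 12) _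

/-- The conductor exponent, computed from a minimal model all of whose integral transforms in Tate
normal form have the same number of components. -/
theorem conductorExponent_eq {W : WeierstrassCurve K} (V : WeierstrassCurve R)
    (C₀ : VariableChange K) (h₀ : C₀ • W = V.baseChange K) (N m : ℕ) (hN : addVal R V.Δ = N)
    (hN12 : N < 12) (t₀ : KodairaType) (ht₀ : V.IsTateNormalForm R t₀)
    (hm : ∀ (C : VariableChange R) (t : KodairaType), (C • V).IsTateNormalForm R t →
      t.numComponents = m) : W.conductorExponent R = N + 1 - m := by
  have hV : addVal R V.Δ < 12 := by rw [hN]; exact_mod_cast hN12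
  have hΔ : V.Δ ≠ 0 := by
    intro h
    rw [h, addVal_zero] at hV
    exact not_top_lt hV
  have key (V' : WeierstrassCurve R) (C : VariableChange K) (hC : C • W = V'.baseChange K)
      (hmin : IsMinimal R (V'.baseChange K)) : ∃ C' : VariableChange R, C' • V = V' := by
    have h : (C * C₀⁻¹) • V.baseChange K = V'.baseChange K := by
      rw [← h₀, mul_smul, inv_smul_smul, hC]
    exact exists_variableChange_eq_map h hV
      ((addVal_le_iff_dvd.2 (Δ_dvd_Δ_of_isMinimal h hmin hΔ)).trans_lt hV)
  have hT : W.HasKodairaType R (W.kodairaType R) :=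
    Classical.epsilon_spec ⟨t₀, V, ⟨C₀, h₀⟩, isMinimal_of_addVal_Δ_lt hV, ht₀⟩
  obtain ⟨V', ⟨C, hC⟩, hmin, hV'⟩ := hT
  obtain ⟨C', rfl⟩ := key V' C hC hmin
  obtain ⟨C'', hC''⟩ := key ((W.minimal R).integralModel R) (W.exists_isMinimal R).choose
    (baseChange_integralModel_eq R (W.minimal R)).symm
    (by rw [baseChange_integralModel_eq]; infer_instance)
  rw [conductorExponent, hm C' _ hV', ← hC'', addVal_Δ_variableChange, hN]
  rfl

theorem IsTateNormalForm.multiplicative_or_additive {ϖ : R} (hϖ : Irreducible ϖ)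
    {V : WeierstrassCurve R} {t : KodairaType} (h : V.IsTateNormalForm R t) :
    (∃ n, t = .I n) ∨ (ϖ ∣ V.a₁ ∧ ϖ ∣ V.a₂ ∧ ϖ ∣ V.a₃ ∧ ϖ ∣ V.a₄ ∧ ϖ ∣ V.a₆) := by
  have key {a : R} {m : ℕ∞} (hm : m ≤ addVal R a) (h1 : 1 ≤ m) : ϖ ∣ a := by
    simpa using hϖ.pow_dvd_of_le_addVal hm 1 (by simpa using h1)
  have cast_le {k : ℕ} (hk : 1 ≤ k) : (1 : ℕ∞) ≤ k := by exact_mod_cast hk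
  rcases t with n | _ | _ | _ | n | _ | _ | _
  · exact Or.inl ⟨n, rfl⟩
  all_goals right
  · obtain ⟨h1, h2, h3, h4, h6⟩ := h
    exact ⟨key h1 le_rfl, key h2 le_rfl, key h3 le_rfl, key h4 le_rfl, key h6.ge le_rfl⟩
  · obtain ⟨h1, h2, h3, h4, h6⟩ := h
    exact ⟨key h1 le_rfl, key h2 le_rfl, key h3 le_rfl, key h4.ge le_rfl, key h6 (by norm_num)⟩
  · obtain ⟨h1, h2, h3, h4, h6, -⟩ := h
    exact ⟨key h1 le_rfl, key h2 le_rfl, key h3 le_rfl, key h4 (by norm_num),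
      key h6 (by norm_num)⟩
  · rcases n with _ | n
    · obtain ⟨h1, h2, h3, h4, h6, -⟩ := h
      exact ⟨key h1 le_rfl, key h2 le_rfl, key h3 (by norm_num), key h4 (by norm_num),
        key h6 (by norm_num)⟩
    · obtain ⟨h1, h2, ⟨k, hk, h3, h4, h6, -⟩ | ⟨k, hk, h3, h4, h6, -⟩⟩ := h
      all_goals exact ⟨key h1 le_rfl, key h2.ge le_rfl, key h3 (cast_le (by omega)),
        key h4 (cast_le (by omega)), key h6 (cast_le (by omega))⟩
  · obtain ⟨h1, h2, h3, h4, h6, -⟩ := h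
    exact ⟨key h1 le_rfl, key h2 (by norm_num), key h3 (by norm_num), key h4 (by norm_num),
      key h6 (by norm_num)⟩
  · obtain ⟨h1, h2, h3, h4, h6⟩ := h
    exact ⟨key h1 le_rfl, key h2 (by norm_num), key h3 (by norm_num), key h4.ge (by norm_num),
      key h6 (by norm_num)⟩
  · obtain ⟨h1, h2, h3, h4, h6⟩ := h
    exact ⟨key h1 le_rfl, key h2 (by norm_num), key h3 (by norm_num), key h4 (by norm_num),
      key h6.ge (by norm_num)⟩

end Models

end WeierstrassCurve

namespace curveE

theorem isUnit_intCast {p : ℕ} [Fact p.Prime] {z : ℤ} (h : IsCoprime (p : ℤ) z) :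
    IsUnit (z : ℤ_[p]) := by
  rw [PadicInt.isUnit_iff, PadicInt.norm_intCast_eq_one_iff]
  exact h.symm

/-- The defining equation of `curveE` over a commutative ring. -/
def model (R : Type*) [CommRing R] : WeierstrassCurve R := ⟨0, -17, 0, 72, 0⟩

theorem baseChange_eq (p : ℕ) [Fact p.Prime] :
    (1 : VariableChange ℚ_[p]) • curveE.baseChange ℚ_[p] = (model ℤ_[p]).baseChange ℚ_[p] := by
  rw [one_smul]
  ext <;> simp only [curveE, model, baseChange, map_a₁, map_a₂, map_a₃, map_a₄, map_a₆, map_neg,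
    map_ofNat, map_zero]

theorem model_Δ (R : Type*) [CommRing R] : (model R).Δ = 82944 := by
  simp only [model, Δ, b₂, b₄, b₆, b₈]
  ring

theorem conductorExponent_of_ne (p : ℕ) [Fact p.Prime] (h2 : p ≠ 2) (h3 : p ≠ 3) :
    (curveE.baseChange ℚ_[p]).conductorExponent ℤ_[p] = 0 := by
  have hp : p.Prime := Fact.out
  have hΔ : addVal ℤ_[p] (model ℤ_[p]).Δ = 0 := by
    rw [model_Δ, addVal_eq_zero_iff]
    have : IsCoprime (p : ℤ) ((2 ^ 10 * 3 ^ 4 : ℕ) : ℤ) := by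
      rw [Nat.isCoprime_iff_coprime]
      exact (((Nat.coprime_primes hp Nat.prime_two).2 h2).pow_right 10).mul_right
        (((Nat.coprime_primes hp Nat.prime_three).2 h3).pow_right 4)
    simpa using isUnit_intCast this
  rw [conductorExponent_eq (model ℤ_[p]) 1 (baseChange_eq p) 0 1 (by simpa using hΔ) (by norm_num)
    (.I 0) hΔ]
  intro C t ht
  rw [← addVal_Δ_variableChange (model ℤ_[p]) C, addVal_eq_zero_iff] at hΔ
  have hp' := PadicInt.irreducible_p (p := p)
  rcases ht.multiplicative_or_additive hp' with ⟨n, rfl⟩ | ⟨h1, h2, h3, h4, h6⟩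
  · rcases n with _ | n
    · rfl
    · have h : addVal ℤ_[p] (C • model ℤ_[p]).Δ = (n + 1 : ℕ) := ht.2.2.2.2
      rw [addVal_eq_zero_iff.2 hΔ] at h
      exact absurd h.symm (by exact_mod_cast n.succ_ne_zero)
  · refine absurd (isUnit_of_dvd_unit ?_ hΔ) hp'.not_isUnit
    have hb₂ : (p : ℤ_[p]) ∣ (C • model ℤ_[p]).b₂ :=
      dvd_add (h1.pow two_ne_zero) (h2.mul_left 4)
    have hb₄ : (p : ℤ_[p]) ∣ (C • model ℤ_[p]).b₄ := dvd_add (h4.mul_left 2) (h1.mul_right _)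
    have hb₆ : (p : ℤ_[p]) ∣ (C • model ℤ_[p]).b₆ :=
      dvd_add (h3.pow two_ne_zero) (h6.mul_left 4)
    exact dvd_add (dvd_sub (dvd_sub ((hb₂.pow two_ne_zero).neg_right.mul_right _)
      ((hb₄.pow three_ne_zero).mul_left 8)) ((hb₆.pow two_ne_zero).mul_left 27)) (hb₆.mul_left _)

theorem conductorExponent_three : (curveE.baseChange ℚ_[3]).conductorExponent ℤ_[3] = 1 := by
  have hp' : Irreducible (3 : ℤ_[3]) := by simpa using PadicInt.irreducible_p (p := 3)
  have hu (z : ℤ) (h : IsCoprime 3 z) : IsUnit (z : ℤ_[3]) := isUnit_intCast (by simpa using h)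
  have hΔ : addVal ℤ_[3] (model ℤ_[3]).Δ = (4 : ℕ) := by
    rw [model_Δ, show (82944 : ℤ_[3]) = ((1024 : ℤ) : ℤ_[3]) * 3 ^ 4 by norm_num,
      addVal_isUnit_mul (hu _ (by norm_num)), hp'.addVal_pow]
  have hge {a : ℤ_[3]} (h : 3 ∣ a) : 1 ≤ addVal ℤ_[3] a := by
    rwa [← addVal_uniformizer hp', addVal_le_iff_dvd]
  rw [conductorExponent_eq (model ℤ_[3]) 1 (baseChange_eq 3) 4 4 hΔ (by norm_num) (.I 4)]
  · refine ⟨hge (dvd_zero _), hge ⟨24, by simp only [model]; norm_num⟩, hge (dvd_zero _), ?_, hΔ⟩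
    rw [addVal_eq_zero_iff]
    have := hu (-68) (by norm_num)
    simp only [model, b₂]
    convert this using 1
    norm_num
  · intro C t ht
    rcases ht.multiplicative_or_additive hp' with ⟨n, rfl⟩ | ⟨⟨α, h1⟩, ⟨β, h2⟩, -, -, -⟩
    · have h : addVal ℤ_[3] (C • model ℤ_[3]).Δ = n := by
        rcases n with _ | n
        · exact ht
        · exact ht.2.2.2.2
      rw [addVal_Δ_variableChange, hΔ] at h
      have : n = 4 := by exact_mod_cast h.symm
      subst this
      rfl
    · have hc : IsUnit (C • model ℤ_[3]).c₄ := by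
        rw [variableChange_c₄]
        refine (C.u⁻¹.isUnit.pow 4).mul ?_
        have := hu 1168 (by norm_num)
        simp only [model, c₄, b₂, b₄]
        convert this using 1
        norm_num
      refine absurd (isUnit_of_dvd_unit ?_ hc) hp'.not_isUnit
      rw [c₄, b₂, h1, h2]
      exact ⟨3 * (3 * α ^ 2 + 4 * β) ^ 2 - 8 * (C • model ℤ_[3]).b₄, by ring⟩

/-- A model of `curveE` that is in Tate normal form at `2`. -/
noncomputable def modelTwo : WeierstrassCurve ℤ_[2] := ⟨2, 6, 0, -8, 0⟩

theorem irreducible_two : Irreducible (2 : ℤ_[2]) := by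
  simpa using PadicInt.irreducible_p (p := 2)

theorem prime_two : Prime (2 : ℤ_[2]) := irreducible_two.prime

theorem two_dvd_mul_add_one (x : ℤ_[2]) : 2 ∣ x * (x + 1) := by
  obtain ⟨n, hn, h⟩ := PadicInt.exists_mem_range x
  rw [irreducible_two.maximalIdeal_eq, Ideal.mem_span_singleton] at h
  interval_cases n
  · exact (by simpa using h : (2 : ℤ_[2]) ∣ x).mul_right _
  · refine Dvd.dvd.mul_left ?_ _
    have := dvd_add h (dvd_refl 2)
    ring_nf at this ⊢
    simpa [add_comm] using this

theorem not_two_dvd_one : ¬ (2 : ℤ_[2]) ∣ 1 := irreducible_two.not_dvd_one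

theorem numComponents_of_isTateNormalForm {C : VariableChange ℤ_[2]} {t : KodairaType}
    (h : (C • modelTwo).IsTateNormalForm ℤ_[2] t) : t.numComponents = 7 := by
  have hw : IsUnit ((C.u⁻¹ : ℤ_[2]ˣ) : ℤ_[2]) := C.u⁻¹.isUnit
  have e2 := variableChange_a₂ modelTwo C
  have e3 := variableChange_a₃ modelTwo C
  have e4 := variableChange_a₄ modelTwo C
  have e6 := variableChange_a₆ modelTwo C
  have f2 := variableChange_b₂ modelTwo C
  have f6 := variableChange_b₆ modelTwo C
  simp only [b₂, b₄, b₆] at f2 f6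
  change (C • modelTwo).b₂ = _ at f2
  change (C • modelTwo).b₆ = _ at f6
  set w : ℤ_[2] := ((C.u⁻¹ : ℤ_[2]ˣ) : ℤ_[2]) with hw_def
  set V := C • modelTwo with hV
  set r := C.r
  set s := C.s
  set t' := C.t
  simp only [modelTwo] at e2 e3 e4 e6 f2 f6
  have hunit {n : ℕ} {a x : ℤ_[2]} : a ∣ w ^ n * x ↔ a ∣ x := (hw.pow n).dvd_mul_left
  have hI (n : ℕ) : t ≠ .I n := by
    rintro rfl
    rcases n with _ | n
    · have h0 : addVal ℤ_[2] V.Δ = 0 := h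
      rw [hV, addVal_Δ_variableChange, addVal_eq_zero_iff] at h0
      refine irreducible_two.not_isUnit (isUnit_of_dvd_unit ?_ h0)
      exact ⟨41472, by simp only [modelTwo, Δ, b₂, b₄, b₆, b₈]; norm_num⟩
    · have h0 : addVal ℤ_[2] V.b₂ = 0 := h.2.2.2.1
      rw [addVal_eq_zero_iff] at h0
      refine irreducible_two.not_isUnit (isUnit_of_dvd_unit ?_ h0)
      rw [f2]
      exact ⟨w ^ 2 * (14 + 6 * r), by ring⟩
  rcases h.multiplicative_or_additive irreducible_two with ⟨n, rfl⟩ | ⟨-, d2, -, d4, d6⟩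
  · exact absurd rfl (hI n)
  · rw [e4, hunit] at d4
    obtain ⟨ρ, hρ⟩ : 2 ∣ r := by
      obtain ⟨k, hk⟩ := d4
      refine prime_two.dvd_of_dvd_pow (n := 2)
        ⟨k + 4 - 6 * r + (t' + r * s) - r ^ 2 + s * t', by linear_combination hk⟩
    rw [hρ] at e2 e3 e4 e6 f6
    rw [e6, hunit] at d6
    obtain ⟨τ, hτ⟩ : 2 ∣ t' := by
      obtain ⟨k, hk⟩ := d6
      refine prime_two.dvd_of_dvd_pow (n := 2)
        ⟨-k - 8 * ρ + 12 * ρ ^ 2 + 4 * ρ ^ 3 - 2 * ρ * t', by linear_combination -hk⟩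
    rw [e2, hunit] at d2
    obtain ⟨σ, hσ⟩ : 2 ∣ s := by
      obtain ⟨k, hk⟩ := d2
      refine prime_two.dvd_of_dvd_pow (n := 2)
        ⟨-k + 3 - s + 3 * ρ, by linear_combination -hk⟩
    rw [hτ] at e3 e4 e6
    rw [hσ] at e2 e4
    replace e2 : V.a₂ = w ^ 2 * (2 ^ 1 * (3 * (1 + ρ) - 2 * σ - 2 * σ ^ 2)) := by rw [e2]; ring
    replace e3 : V.a₃ = w ^ 3 * (2 ^ 2 * (ρ + τ)) := by rw [e3]; ring
    replace e4 : V.a₄ = w ^ 4 * (2 ^ 2 *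
        (-2 + 6 * ρ - τ - 2 * ρ * σ + 3 * ρ ^ 2 - 2 * σ * τ)) := by rw [e4]; ring
    replace e6 : V.a₆ = w ^ 6 * (2 ^ 2 *
        (-4 * ρ + 6 * ρ ^ 2 + 2 * ρ ^ 3 - τ ^ 2 - 2 * ρ * τ)) := by rw [e6]; ring
    replace f6 : V.b₆ = w ^ 6 * (2 ^ 4 * (-4 * ρ + 7 * ρ ^ 2 + 2 * ρ ^ 3)) := by rw [f6]; ring
    have pow_dvd {n : ℕ} {a : ℤ_[2]} {m : ℕ∞} (hm : m ≤ addVal ℤ_[2] a) (hn : (n : ℕ∞) ≤ m) :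
        2 ^ n ∣ a := irreducible_two.pow_dvd_of_le_addVal hm n hn
    have cancel {k n : ℕ} {x : ℤ_[2]} (h : 2 ^ (k + 1) ∣ w ^ n * (2 ^ k * x)) : 2 ∣ x := by
      rw [hunit, pow_succ] at h
      exact (mul_dvd_mul_iff_left (pow_ne_zero k prime_two.ne_zero)).1 h
    have hτ2 (h : 2 ^ 3 ∣ V.a₆) : 2 ∣ τ := by
      rw [e6] at h
      obtain ⟨k, hk⟩ := cancel h
      exact prime_two.dvd_of_dvd_pow (n := 2)
        ⟨-k - 2 * ρ + 3 * ρ ^ 2 + ρ ^ 3 - ρ * τ, by linear_combination -hk⟩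
    have hdeep (h2 : 2 ∣ ρ) (h4 : 2 ^ 4 ∣ V.a₄) (h6 : 2 ^ 6 ∣ V.a₆) : False := by
      obtain ⟨τ, rfl⟩ := hτ2 ((pow_dvd_pow 2 (by norm_num)).trans h6)
      obtain ⟨ρ, rfl⟩ := h2
      rw [show V.a₄ = w ^ 4 * (2 ^ 3 *
        (-1 + 6 * ρ - τ - 2 * ρ * σ + 6 * ρ ^ 2 - 2 * σ * τ)) by rw [e4]; ring] at h4
      replace h6 := (pow_dvd_pow 2 (by norm_num : 4 + 1 ≤ 6)).trans h6
      rw [show V.a₆ = w ^ 6 * (2 ^ 4 *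
        (-2 * ρ + 6 * ρ ^ 2 + 4 * ρ ^ 3 - τ ^ 2 - 2 * ρ * τ)) by rw [e6]; ring] at h6
      obtain ⟨k, hk⟩ := cancel h6
      obtain ⟨τ, rfl⟩ := prime_two.dvd_of_dvd_pow (n := 2) (a := τ)
        ⟨-k - ρ + 3 * ρ ^ 2 + 2 * ρ ^ 3 - ρ * τ, by linear_combination -hk⟩
      obtain ⟨k, hk⟩ := cancel h4
      exact not_two_dvd_one ⟨-k + 3 * ρ - τ - ρ * σ + 3 * ρ ^ 2 - 2 * σ * τ, by
        linear_combination -hk⟩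
    have hstar (h2 : 2 ^ 2 ∣ V.a₂) (h3 : 2 ^ 3 ∣ V.a₃) (h6 : 2 ^ 3 ∣ V.a₆) : False := by
      obtain ⟨τ, rfl⟩ := hτ2 h6
      rw [e3] at h3
      obtain ⟨k, hk⟩ := cancel h3
      rw [e2] at h2
      obtain ⟨l, hl⟩ := cancel h2
      exact not_two_dvd_one ⟨l - 3 * k + 3 * τ - 1 + σ + σ ^ 2, by
        linear_combination hl - 3 * hk⟩
    have natCast_le {a : ℤ_[2]} {k : ℕ} (n : ℕ) (hk : (k : ℕ∞) ≤ addVal ℤ_[2] a) (hn : n ≤ k) :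
        2 ^ n ∣ a := pow_dvd hk (by exact_mod_cast hn)
    rcases t with n | _ | _ | _ | n | _ | _ | _
    · exact absurd rfl (hI n)
    · obtain ⟨-, -, -, -, h6⟩ := h
      exact absurd (e6 ▸ (Dvd.intro _ rfl).mul_left _)
        (irreducible_two.not_pow_dvd_of_addVal_eq h6 2 (by norm_num))
    · obtain ⟨-, -, -, h4, -⟩ := h
      exact absurd (e4 ▸ (Dvd.intro _ rfl).mul_left _)
        (irreducible_two.not_pow_dvd_of_addVal_eq h4 2 (by norm_num))
    · obtain ⟨-, -, -, -, -, h6⟩ := h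
      exact absurd (f6 ▸ (Dvd.intro _ rfl).mul_left _)
        (irreducible_two.not_pow_dvd_of_addVal_eq h6 4 (by norm_num))
    · rcases n with _ | n
      · exfalso
        obtain ⟨-, -, -, -, h6, hD⟩ := h
        obtain ⟨τ, rfl⟩ := hτ2 (pow_dvd h6 (by norm_num))
        obtain ⟨m, hm⟩ := two_dvd_mul_add_one ρ
        set A := 3 * (1 + ρ) - 2 * σ - 2 * σ ^ 2 with hA
        set B := -2 + 6 * ρ - 2 * τ - 2 * ρ * σ + 3 * ρ ^ 2 - 2 * σ * (2 * τ) with hB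
        have hAB : A * B = 2 * (9 * ρ * m + 3 * (-1 + 3 * ρ - τ - ρ * σ - 2 * σ * τ) * (1 + ρ)
            - (σ + σ ^ 2) * B) := by
          rw [hA, hB]
          linear_combination 9 * ρ * hm
        replace e6 : V.a₆ = w ^ 6 * (2 ^ 4 * (ρ * m + ρ ^ 2 - ρ - τ ^ 2 - ρ * τ)) := by
          rw [e6]
          linear_combination w ^ 6 * 8 * ρ * hm
        refine irreducible_two.not_pow_dvd_of_addVal_eq hD 7 (by norm_num) ?_
        generalize 9 * ρ * m + 3 * (-1 + 3 * ρ - τ - ρ * σ - 2 * σ * τ) * (1 + ρ)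
            - (σ + σ ^ 2) * B = E at hAB
        generalize ρ * m + ρ ^ 2 - ρ - τ ^ 2 - ρ * τ = F at e6
        refine ⟨w ^ 12 * (2 * E ^ 2 - 2 * B ^ 3 - 4 * A ^ 3 * F - 54 * F ^ 2 + 36 * E * F), ?_⟩
        rw [e2, e4, e6]
        linear_combination w ^ 12 * (64 * (A * B + 2 * E) + 64 * 36 * F) * hAB
      · obtain ⟨-, h2, h⟩ := h
        have hρ2 : 2 ∣ ρ := by
          refine (prime_two.dvd_or_dvd (two_dvd_mul_add_one ρ)).resolve_right ?_
          rintro ⟨l, hl⟩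
          refine irreducible_two.not_pow_dvd_of_addVal_eq h2 2 (by norm_num) ?_
          rw [e2]
          exact ⟨w ^ 2 * (3 * l - σ - σ ^ 2), by linear_combination w ^ 2 * 6 * hl⟩
        obtain ⟨k, hk, -, h4, h6, hb⟩ | ⟨k, hk, -, h4, h6, -⟩ := h
        · have hk3 : 3 ≤ k := by
            by_contra hk3
            refine irreducible_two.not_pow_dvd_of_addVal_eq hb 6
              (by exact_mod_cast (by omega : 2 * k < 6)) ?_
            obtain ⟨ρ, rfl⟩ := hρ2
            rw [f6]
            exact ⟨w ^ 6 * (-2 * ρ + 7 * ρ ^ 2 + 4 * ρ ^ 3), by ring⟩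
          exact (hdeep hρ2 (natCast_le 4 h4 (by omega)) (natCast_le 6 h6 (by omega))).elim
        · rcases (by omega : n = 1 ∨ 3 ≤ k) with rfl | hk3
          · rfl
          · exact (hdeep hρ2 (natCast_le 4 h4 (by omega)) (natCast_le 6 h6 (by omega))).elim
    · rfl
    · obtain ⟨-, h2, h3, -, h6⟩ := h
      exact (hstar (pow_dvd h2 le_rfl) (pow_dvd h3 le_rfl) (pow_dvd h6 (by norm_num))).elim
    · obtain ⟨-, h2, h3, -, h6⟩ := h
      exact (hstar (pow_dvd h2 le_rfl) (pow_dvd h3 le_rfl) (pow_dvd h6.ge (by norm_num))).elim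

theorem conductorExponent_two : (curveE.baseChange ℚ_[2]).conductorExponent ℤ_[2] = 4 := by
  have hu (z : ℤ) (h : IsCoprime 2 z) : IsUnit (z : ℤ_[2]) := isUnit_intCast (by simpa using h)
  have hpow (z : ℤ) (n : ℕ) (h : IsCoprime 2 z) : addVal ℤ_[2] (z * 2 ^ n) = n := by
    rw [addVal_isUnit_mul (hu z h), irreducible_two.addVal_pow]
  have hΔ : addVal ℤ_[2] modelTwo.Δ = (10 : ℕ) := by
    rw [← hpow 81 10 (by norm_num)]
    congr 1
    simp only [modelTwo, Δ, b₂, b₄, b₆, b₈]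
    norm_num
  rw [conductorExponent_eq modelTwo ⟨1, 8, 1, 0⟩ ?_ 10 7 hΔ (by norm_num) (.IStar 2) ?_
    (fun _ _ ↦ numComponents_of_isTateNormalForm)]
  · ext <;> simp only [variableChange_def, curveE, modelTwo, baseChange, map_a₁, map_a₂, map_a₃,
      map_a₄, map_a₆, map_neg, map_ofNat, map_zero] <;> norm_num
  · have h1 : addVal ℤ_[2] 2 = 1 := addVal_uniformizer irreducible_two
    refine ⟨h1.ge, ?_, Or.inr ⟨2, rfl, ?_, ?_, ?_, ?_⟩⟩
    · have := hpow 3 1 (by norm_num)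
      simp only [modelTwo]
      norm_num at this ⊢
      exact this
    · simp [modelTwo]
    · have := hpow (-1) 3 (by norm_num)
      simp only [modelTwo]
      norm_num at this ⊢
      exact this.ge
    · simp [modelTwo]
    · have := hpow 1 6 (by norm_num)
      simp only [modelTwo]
      norm_num at this ⊢
      exact this

theorem finprod_primes_two_three (q r : Nat.Primes) (hq : (q : ℕ) = 2) (hr : (r : ℕ) = 3) :
    ∏ᶠ p : Nat.Primes, (if (p : ℕ) = 2 then 16 else if (p : ℕ) = 3 then 3 else 1) = 48 := by
  rw [finprod_eq_prod_of_mulSupport_subset (s := {q, r})]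
  · have hqr : q ≠ r := fun h ↦ by simp [h, hr] at hq
    rw [Finset.prod_pair hqr, hq, hr]
    norm_num
  · intro p hp
    rw [Function.mem_mulSupport] at hp
    simp only [Finset.coe_insert, Finset.coe_singleton, Set.mem_insert_iff,
      Set.mem_singleton_iff, ← Nat.Primes.coe_nat_inj, hq, hr]
    by_contra! h
    simp [h.1, h.2] at hp

theorem conductor_eq : curveE.conductor = 48 := by
  rw [WeierstrassCurve.conductor]
  have h (p : Nat.Primes) : (haveI : Fact (p : ℕ).Prime := ⟨p.2⟩
      (p : ℕ) ^ (curveE.baseChange ℚ_[p]).conductorExponent ℤ_[p]) =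
      if (p : ℕ) = 2 then 16 else if (p : ℕ) = 3 then 3 else 1 := by
    obtain ⟨p, hp⟩ := p
    have : Fact p.Prime := ⟨hp⟩
    dsimp only
    split_ifs with h2 h3
    · subst h2
      rw [conductorExponent_two]
      norm_num
    · subst h3
      rw [conductorExponent_three]
      norm_num
    · rw [conductorExponent_of_ne p h2 h3, pow_zero]
  rw [finprod_congr h]
  exact finprod_primes_two_three ⟨2, Nat.prime_two⟩ ⟨3, Nat.prime_three⟩ rfl rfl

end curveE

theorem mainTheorem2 :
    Module.Finite ℤ curveE.toAffine.Point ∧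
      Module.finrank ℤ curveE.toAffine.Point = 0 ∧
      Nonempty (AddCommGroup.torsion curveE.toAffine.Point ≃+ ZMod 2 × ZMod 4) ∧
      curveE.conductor = 48 :=
  ⟨curveE_points.1, curveE_points.2.1, curveE_points.2.2, curveE.conductor_eq⟩
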